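/- Let $L>0$, $\Omega=(0,L)^3$, $N=2K+1$ with $K\ge 0$ an integer, and $h=L/N$. For a real-valued function $\mathbf f$ on $\mathbb R^3$, let $f$ be its grid version $f_{i,j,k}=\mathbf f(x_i,y_j,z_k)$, where $x_i=(i-\tfrac12)h$, $y_j=(j-\tfrac12)h$, $z_k=(k-\tfrac12)h$. Put $$\langle f,g\rangle=h^3\sum_{i,j,k=1}^N f_{i,j,k}\,g_{i,j,k},\qquad (\mathbf f,\mathbf g)=\int_\Omega \mathbf f\,\mathbf g\,d\mathbf x .$$ Let $\mathcal B^K$ be the space of real-valued trigonometric polynomials $\sum_{\ell,m,n=-K}^{K}c_{\ell,m,n}\,e^{2\pi i(\ell x+my+nz)/L}$ with complex coefficients. Let $\|\mathbf f\|_{H^m}=\bigl(\sum_{|\alpha|\le m}\|\partial^\alpha\mathbf f\|_{L^2(\Omega)}^2\bigr)^{1/2}$ be the norm of the $L$-periodic Sobolev space $H^m$, where $\partial^\alpha$ denotes the weak derivative with respect to smooth $L$-periodic test functions; $\|\mathbf f\|_{H^m}=\infty$ if $\mathbf f\notin H^m$, and $0\cdot\infty=0$. (1) If $\mathbf f,\mathbf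 g\in\mathcal B^K$, then $\langle f,g\rangle=(\mathbf f,\mathbf g)$. (2) There is a constant $C>0$ depending only on $L$ (in particular independent of $h$, $\mathbf f$ and $\mathbf g$) such that, for every integer $K\ge 0$ and all continuous functions $\mathbf f,\mathbf g:\mathbb R^3\to\mathbb R$ that are $L$-periodic in each variable, $$\bigl|\langle f,g\rangle-(\mathbf f,\mathbf g)\bigr|\le C\,h^8\bigl(\|\mathbf f\|_{H^8}\|\mathbf g\|_{H^2}+\|\mathbf f\|_{H^2}\|\mathbf g\|_{H^8}\bigr).$$ -/

import Mathlib

open MeasureTheory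
open scoped ENNReal ContDiff

noncomputable section

namespace PeriodicGrid

/-- The cube `Ω = (0, L)³`. -/
def cell (L : ℝ) : Set (Fin 3 → ℝ) :=
  Set.pi Set.univ fun _ => Set.Ioo 0 L

/-- `f` is `L`-periodic in each of the three variables. -/
def IsPeriodic (L : ℝ) (f : (Fin 3 → ℝ) → ℝ) : Prop :=
  ∀ j : Fin 3, Function.Periodic f (Pi.single j L)

/-- The set of frequencies `{-K, …, K}³`. -/
def freqs (K : ℕ) : Finset (Fin 3 → ℤ) :=
  Fintype.piFinset fun _ => Finset.Icc (-(K : ℤ)) (K : ℤ)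

/-- The Fourier mode `x ↦ exp (2 π i k·x / L)`. -/
def fourierMode (L : ℝ) (k : Fin 3 → ℤ) (x : Fin 3 → ℝ) : ℂ :=
  Complex.exp (2 * (Real.pi : ℂ) * Complex.I * (∑ j, (k j : ℂ) * (x j : ℂ)) / (L : ℂ))

/-- The space of (real-valued) `L`-periodic trigonometric polynomials of degree at most `K` in each
variable. -/
def trigPoly (L : ℝ) (K : ℕ) : Set ((Fin 3 → ℝ) → ℝ) :=
  {f | ∃ c : (Fin 3 → ℤ) → ℂ, ∀ x, (f x : ℂ) = ∑ k ∈ freqs K, c k * fourierMode L k x}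

/-- The uniform grid point `(x_i, y_j, z_k)`, where `x_i = (i - 1/2) h` and similarly for the other
coordinates. -/
def gridPoint (h : ℝ) (i : Fin 3 → ℤ) : Fin 3 → ℝ :=
  fun j => ((i j : ℝ) - 1 / 2) * h

/-- The grid version of a function: its values at the grid points. -/
def gridFun (h : ℝ) (f : (Fin 3 → ℝ) → ℝ) : (Fin 3 → ℤ) → ℝ :=
  fun i => f (gridPoint h i)

/-- The discrete inner product `h³ ∑_{i,j,k=1}^N f_{i,j,k} g_{i,j,k}` of grid functions. -/
def discreteInner (h : ℝ) (N : ℕ) (f g : (Fin 3 → ℤ) → ℝ) : ℝ :=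
  h ^ 3 * ∑ i ∈ Fintype.piFinset (fun _ : Fin 3 => Finset.Icc (1 : ℤ) (N : ℤ)), f i * g i

/-- The `L²` inner product on `Ω`. -/
def l2Inner (L : ℝ) (f g : (Fin 3 → ℝ) → ℝ) : ℝ :=
  ∫ x in cell L, f x * g x

/-- The classical partial derivative in the `j`-th variable. -/
def partialDeriv (j : Fin 3) (φ : (Fin 3 → ℝ) → ℝ) : (Fin 3 → ℝ) → ℝ :=
  fun x => fderiv ℝ φ x (Pi.single j 1)

/-- The classical partial derivative `∂^α = ∂_x^{α 0} ∂_y^{α 1} ∂_z^{α 2}`. -/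
def multiDeriv (α : Fin 3 → ℕ) (φ : (Fin 3 → ℝ) → ℝ) : (Fin 3 → ℝ) → ℝ :=
  (partialDeriv 0)^[α 0] ((partialDeriv 1)^[α 1] ((partialDeriv 2)^[α 2] φ))

/-- `v ∈ L²(Ω)` is the weak derivative `∂^α f` of the periodic function `f`; the test functions are
the smooth `L`-periodic functions. -/
structure IsWeakDeriv (L : ℝ) (α : Fin 3 → ℕ) (f v : (Fin 3 → ℝ) → ℝ) : Prop where
  memLp : MemLp v 2 (volume.restrict (cell L))
  integral_eq : ∀ φ : (Fin 3 → ℝ) → ℝ, ContDiff ℝ ∞ φ → IsPeriodic L φ →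
    ∫ x in cell L, f x * multiDeriv α φ x = (-1) ^ (∑ j, α j) * ∫ x in cell L, v x * φ x

/-- The multi-indices `α` with `|α| ≤ m`. -/
def multiIndices (m : ℕ) : Finset (Fin 3 → ℕ) :=
  (Fintype.piFinset fun _ => Finset.range (m + 1)).filter fun α => ∑ j, α j ≤ m

/-- The periodic Sobolev norm `‖f‖_{H^m} = (∑_{|α| ≤ m} ‖∂^α f‖²_{L²(Ω)})^{1/2}`. Weak derivatives are
unique almost everywhere, so that the infimum runs over a single value if `f` lies in the periodic
Sobolev space `H^m`; otherwise it is empty and the norm is `∞`. -/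
def sobolevNorm (L : ℝ) (m : ℕ) (f : (Fin 3 → ℝ) → ℝ) : ℝ≥0∞ :=
  ⨅ (v : (Fin 3 → ℕ) → (Fin 3 → ℝ) → ℝ)
    (_ : ∀ α ∈ multiIndices m, IsWeakDeriv L α f (v α)),
    (∑ α ∈ multiIndices m, eLpNorm (v α) 2 (volume.restrict (cell L)) ^ 2) ^ (1 / 2 : ℝ)

end PeriodicGrid

end

noncomputable section

namespace PeriodicGrid

/-! ### Fourier modes -/

/-! Write `e_k` for the Fourier modes. The quadrature error on a single mode, `aliasing`, vanishes
unless `k` is nonzero and every coordinate of `k` is divisible by `N` (`aliasing_zero`,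
`aliasing_of_not_dvd`), and it never exceeds `L³`. If `f = ∑ a_k e_k` and `g = ∑ b_l e_l` converge
absolutely, the error for the product is `∑ a_k b_l aliasing(k + l)` (`quadrature_error_eq_tsum`).
For trigonometric polynomials of degree at most `K`, the coordinates of `k + l` are at most `2K < N`
in absolute value, so divisibility forces `k + l = 0` and the error is zero.

In general a contributing pair has `‖k‖ ≥ N/2` or `‖l‖ ≥ N/2`. For pairs with `k` high and weight `w
= 1 + ‖·‖`, write `|a_k||b_l| = (w_k⁸|a_k| w_l⁻²)(w_l²|b_l| w_k⁻⁸)` and apply Cauchy-Schwarz over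
the aliased pairs (`tsum_alias_high_sq_le`). With one index fixed, the other runs through a residue
class modulo `N`: the sum of `w_l⁻⁴` is bounded uniformly (`4 > 3`, which is why `H²` suffices for
the second factor), and the sum of `w_k⁻¹⁶` over high `k` is `O(N⁻¹⁶)`. The square root gives `h⁸`.

Two analytic facts link this to the statement. Testing weak derivatives against modes, together with
Bessel's inequality, bounds weighted coefficient sums by Sobolev norms
(`weightedSq_le_sobolevNorm`). A continuous periodic function with summable coefficients equals its
Fourier series on the cell (`eq_tsum_fourierCoeffCell`), by density of trigonometric polynomials on
the torus. -/

lemma fourierMode_eq_prod (L : ℝ) (k : Fin 3 → ℤ) (x : Fin 3 → ℝ) :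
    fourierMode L k x =
      ∏ j, Complex.exp (2 * (Real.pi : ℂ) * Complex.I * ((k j : ℂ) * (x j : ℂ)) / (L : ℂ)) := by
  rw [fourierMode, ← Complex.exp_sum, Finset.mul_sum, Finset.sum_div]

lemma fourierMode_eq_exp_ofReal (L : ℝ) (k : Fin 3 → ℤ) (x : Fin 3 → ℝ) :
    fourierMode L k x =
      Complex.exp (((2 * Real.pi * (∑ j, (k j : ℝ) * x j) / L : ℝ) : ℂ) * Complex.I) := by
  rw [fourierMode]
  congr 1
  push_cast
  ring

lemma fourierMode_zero (L : ℝ) (x : Fin 3 → ℝ) : fourierMode L 0 x = 1 := by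
  simp [fourierMode]

lemma fourierMode_add (L : ℝ) (k l : Fin 3 → ℤ) (x : Fin 3 → ℝ) :
    fourierMode L (k + l) x = fourierMode L k x * fourierMode L l x := by
  simp only [fourierMode, ← Complex.exp_add]
  congr 1
  simp only [Pi.add_apply, Int.cast_add, add_mul, Finset.sum_add_distrib]
  ring

lemma norm_fourierMode (L : ℝ) (k : Fin 3 → ℤ) (x : Fin 3 → ℝ) : ‖fourierMode L k x‖ = 1 := by
  rw [fourierMode_eq_exp_ofReal, Complex.norm_exp_ofReal_mul_I]

lemma conj_fourierMode (L : ℝ) (k : Fin 3 → ℤ) (x : Fin 3 → ℝ) :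
    (starRingEnd ℂ) (fourierMode L k x) = fourierMode L (-k) x := by
  rw [fourierMode_eq_exp_ofReal, fourierMode_eq_exp_ofReal, ← Complex.exp_conj]
  congr 1
  simp only [map_mul, Complex.conj_ofReal, Complex.conj_I, Pi.neg_apply, Int.cast_neg, neg_mul,
    Finset.sum_neg_distrib]
  push_cast
  ring

@[fun_prop]
lemma continuous_fourierMode (L : ℝ) (k : Fin 3 → ℤ) : Continuous (fourierMode L k) := by
  unfold fourierMode
  fun_prop

lemma fourierMode_periodic {L : ℝ} (hL : L ≠ 0) (k : Fin 3 → ℤ) (j : Fin 3) :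
    Function.Periodic (fourierMode L k) (Pi.single j L) := by
  intro x
  have hL' : (L : ℂ) ≠ 0 := by exact_mod_cast hL
  rw [fourierMode, fourierMode, Complex.exp_eq_exp_iff_exists_int]
  refine ⟨k j, ?_⟩
  have : ∑ i, (k i : ℂ) * (((x + Pi.single j L : Fin 3 → ℝ) i : ℝ) : ℂ) =
      ∑ i, (k i : ℂ) * (x i : ℂ) + k j * L := by
    simp only [Pi.add_apply, Complex.ofReal_add, mul_add, Finset.sum_add_distrib]
    congr 1
    rw [Finset.sum_eq_single j]
    · simp
    · intro b _ hb
      simp [Pi.single_eq_of_ne hb]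
    · simp
  rw [this]
  field_simp

/-! ### Integrals and grid sums of Fourier modes. -/

lemma volume_restrict_cell (L : ℝ) :
    (volume : Measure (Fin 3 → ℝ)).restrict (cell L) =
      Measure.pi fun _ : Fin 3 => (volume : Measure ℝ).restrict (Set.Ioo 0 L) := by
  rw [cell, volume_pi, Measure.restrict_pi_pi]

instance (L : ℝ) : IsFiniteMeasure ((volume : Measure (Fin 3 → ℝ)).restrict (cell L)) := by
  rw [volume_restrict_cell]
  infer_instance

lemma integral_exp_Ioo {L : ℝ} (hL : 0 < L) (m : ℤ) :
    ∫ t in Set.Ioo 0 L, Complex.exp (2 * (Real.pi : ℂ) * Complex.I * ((m : ℂ) * (t : ℂ)) / (L : ℂ)) =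
      if m = 0 then (L : ℂ) else 0 := by
  have hL' : (L : ℂ) ≠ 0 := by exact_mod_cast hL.ne'
  rw [← integral_Ioc_eq_integral_Ioo, ← intervalIntegral.integral_of_le hL.le]
  split_ifs with hm
  · simp [hm]
  · have hm' : (m : ℂ) ≠ 0 := by exact_mod_cast hm
    have hc : 2 * (Real.pi : ℂ) * Complex.I * m / L ≠ 0 := by
      have := Complex.ofReal_ne_zero.2 Real.pi_ne_zero
      simp [hm', hL', this]
    have : ∀ t : ℝ, Complex.exp (2 * (Real.pi : ℂ) * Complex.I * ((m : ℂ) * (t : ℂ)) / (L : ℂ)) =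
        Complex.exp ((2 * (Real.pi : ℂ) * Complex.I * m / L) * t) := by
      intro t
      congr 1
      ring
    simp only [this]
    rw [integral_exp_mul_complex hc]
    have h1 : 2 * (Real.pi : ℂ) * Complex.I * m / L * L = m * (2 * Real.pi * Complex.I) := by
      field_simp
    rw [h1, Complex.exp_int_mul_two_pi_mul_I]
    simp

lemma integral_fourierMode {L : ℝ} (hL : 0 < L) (k : Fin 3 → ℤ) :
    ∫ x in cell L, fourierMode L k x = if k = 0 then (L : ℂ) ^ 3 else 0 := by
  simp only [fourierMode_eq_prod]
  rw [volume_restrict_cell, integral_fintype_prod_eq_prod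
    (f := fun (j : Fin 3) (t : ℝ) =>
      Complex.exp (2 * (Real.pi : ℂ) * Complex.I * ((k j : ℂ) * (t : ℂ)) / (L : ℂ)))]
  simp only [integral_exp_Ioo hL]
  split_ifs with hk
  · simp [hk]
  · obtain ⟨j, hj⟩ := Function.ne_iff.1 hk
    exact Finset.prod_eq_zero (Finset.mem_univ j) (if_neg hj)

/-- A geometric sum of powers of an `N`-th root of unity `ζ ≠ 1`; the half-step shift of the nodes
only contributes a common phase. -/
lemma sum_exp_grid_eq_zero {L h : ℝ} (hL : 0 < L) {N : ℕ} (hN : 0 < N) (hh : h = L / N) {m : ℤ}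
    (hm : ¬ (N : ℤ) ∣ m) :
    ∑ i ∈ Finset.Icc (1 : ℤ) N,
      Complex.exp (2 * (Real.pi : ℂ) * Complex.I *
        ((m : ℂ) * ((((i : ℝ) - 1 / 2) * h : ℝ) : ℂ)) / (L : ℂ)) = 0 := by
  have hL' : (L : ℂ) ≠ 0 := by exact_mod_cast hL.ne'
  have hN' : (N : ℂ) ≠ 0 := by exact_mod_cast hN.ne'
  set ζ : ℂ := Complex.exp (2 * Real.pi * Complex.I * m / N) with hζ
  have hζN : ζ ^ N = 1 := by
    rw [hζ, ← Complex.exp_nat_mul, mul_div_cancel₀ _ hN', mul_comm, Complex.exp_int_mul_two_pi_mul_I]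
  have hζ1 : ζ ≠ 1 := by
    intro h1
    obtain ⟨n, hn⟩ := Complex.exp_eq_one_iff.1 h1
    apply hm
    refine ⟨n, ?_⟩
    have hpi := Complex.ofReal_ne_zero.2 Real.pi_ne_zero
    have : (m : ℂ) = N * n := by
      field_simp at hn
      have hI := Complex.I_ne_zero
      apply mul_left_cancel₀ (mul_ne_zero two_ne_zero (mul_ne_zero hpi hI))
      linear_combination (2 * (Real.pi : ℂ) * Complex.I) * hn
    exact_mod_cast this
  have hterm : ∀ n : ℕ, Complex.exp (2 * (Real.pi : ℂ) * Complex.I *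
        ((m : ℂ) * (((((n + 1 : ℤ) : ℝ) - 1 / 2) * h : ℝ) : ℂ)) / (L : ℂ)) =
      Complex.exp (Real.pi * Complex.I * m / N) * ζ ^ n := by
    intro n
    rw [hζ, ← Complex.exp_nat_mul, ← Complex.exp_add]
    congr 1
    rw [hh]
    push_cast
    field_simp
    ring
  have hsum : ∑ i ∈ Finset.Icc (1 : ℤ) N,
      Complex.exp (2 * (Real.pi : ℂ) * Complex.I *
        ((m : ℂ) * ((((i : ℝ) - 1 / 2) * h : ℝ) : ℂ)) / (L : ℂ)) =
      ∑ n ∈ Finset.range N, Complex.exp (2 * (Real.pi : ℂ) * Complex.I *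
        ((m : ℂ) * (((((n + 1 : ℤ) : ℝ) - 1 / 2) * h : ℝ) : ℂ)) / (L : ℂ)) := by
    symm
    refine Finset.sum_bij (fun n _ => (n + 1 : ℤ)) ?_ ?_ ?_ ?_
    · intro n hn
      simp only [Finset.mem_range, Finset.mem_Icc] at hn ⊢
      omega
    · intro a _ b _ hab
      simpa using hab
    · intro i hi
      simp only [Finset.mem_Icc] at hi
      refine ⟨(i - 1).toNat, ?_, ?_⟩
      · simp only [Finset.mem_range]
        omega
      · omega
    · intro n _
      rfl
  rw [hsum, Finset.sum_congr rfl fun n _ => hterm n, ← Finset.mul_sum, geom_sum_eq hζ1, hζN]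
  simp

/-- The quadrature error of the grid sum on the Fourier mode `k`. -/
def aliasing (L : ℝ) (N : ℕ) (h : ℝ) (k : Fin 3 → ℤ) : ℂ :=
  (h : ℂ) ^ 3 * ∑ i ∈ Fintype.piFinset (fun _ : Fin 3 => Finset.Icc (1 : ℤ) (N : ℤ)),
    fourierMode L k (gridPoint h i) - ∫ x in cell L, fourierMode L k x

lemma card_grid (N : ℕ) :
    (Fintype.piFinset (fun _ : Fin 3 => Finset.Icc (1 : ℤ) (N : ℤ))).card = N ^ 3 := by
  simp [Fintype.card_piFinset]

lemma aliasing_zero {L h : ℝ} (hL : 0 < L) {N : ℕ} (hN : 0 < N) (hh : h = L / N) :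
    aliasing L N h 0 = 0 := by
  have hN' : (N : ℂ) ≠ 0 := by exact_mod_cast hN.ne'
  rw [aliasing, integral_fourierMode hL]
  simp only [fourierMode_zero, Finset.sum_const, card_grid, hh]
  push_cast
  simp only [nsmul_eq_mul]
  push_cast
  field_simp
  ring

/-- The grid sum factors over the coordinates, and a coordinate not divisible by `N` makes its
factor vanish; the integral vanishes because `k ≠ 0`. -/
lemma aliasing_of_not_dvd {L h : ℝ} (hL : 0 < L) {N : ℕ} (hN : 0 < N) (hh : h = L / N)
    {k : Fin 3 → ℤ} (hk : ¬ ∀ j, (N : ℤ) ∣ k j) : aliasing L N h k = 0 := by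
  push Not at hk
  obtain ⟨j, hj⟩ := hk
  have hk0 : k ≠ 0 := by
    rintro rfl
    exact hj (dvd_zero _)
  rw [aliasing, integral_fourierMode hL, if_neg hk0, sub_zero]
  simp only [fourierMode_eq_prod, gridPoint]
  rw [← Finset.prod_univ_sum (t := fun _ : Fin 3 => Finset.Icc (1 : ℤ) (N : ℤ))
    (f := fun (j : Fin 3) (i : ℤ) => Complex.exp (2 * (Real.pi : ℂ) * Complex.I *
        ((k j : ℂ) * ((((i : ℝ) - 1 / 2) * h : ℝ) : ℂ)) / (L : ℂ))),
    Finset.prod_eq_zero (Finset.mem_univ j) (sum_exp_grid_eq_zero hL hN hh hj), mul_zero]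

lemma norm_aliasing_le {L h : ℝ} (hL : 0 < L) {N : ℕ} (hN : 0 < N) (hh : h = L / N)
    (k : Fin 3 → ℤ) : ‖aliasing L N h k‖ ≤ L ^ 3 := by
  rcases eq_or_ne k 0 with rfl | hk
  · rw [aliasing_zero hL hN hh, norm_zero]
    positivity
  · have hh0 : 0 ≤ h := by rw [hh]; positivity
    rw [aliasing, integral_fourierMode hL, if_neg hk, sub_zero, norm_mul, norm_pow,
      Complex.norm_real, Real.norm_of_nonneg hh0]
    have : ‖∑ i ∈ Fintype.piFinset (fun _ : Fin 3 => Finset.Icc (1 : ℤ) (N : ℤ)),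
        fourierMode L k (gridPoint h i)‖ ≤ (N : ℝ) ^ 3 := by
      refine (norm_sum_le _ _).trans ?_
      simp [norm_fourierMode]
    calc h ^ 3 * _ ≤ h ^ 3 * (N : ℝ) ^ 3 := by gcongr
      _ = L ^ 3 := by
        rw [hh]
        field_simp


/-! ### Lattice sums -/

/-- The weight `1 + ‖k‖` of the frequency `k`. -/
def freqWeight (k : Fin 3 → ℤ) : ℝ≥0∞ := ENNReal.ofReal (1 + ‖k‖)

lemma freqWeight_ne_zero (k : Fin 3 → ℤ) : freqWeight k ≠ 0 := by
  rw [freqWeight, Ne, ENNReal.ofReal_eq_zero, not_le]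
  positivity

lemma freqWeight_ne_top (k : Fin 3 → ℤ) : freqWeight k ≠ ⊤ := ENNReal.ofReal_ne_top

lemma one_le_freqWeight (k : Fin 3 → ℤ) : 1 ≤ freqWeight k := by
  rw [freqWeight, ENNReal.one_le_ofReal]
  linarith [norm_nonneg k]

lemma summable_norm_inv_pow {n : ℕ} (hn : 3 < n) :
    Summable fun k : Fin 3 → ℤ => ‖k‖⁻¹ ^ n := by
  set B := Pi.basisFun ℝ (Fin 3)
  set Λ : Submodule ℤ (Fin 3 → ℝ) := Submodule.span ℤ (Set.range B)
  have hrank : Module.finrank ℤ Λ = 3 := by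
    rw [ZLattice.rank ℝ Λ]
    simp
  have hs := ZLattice.summable_norm_pow_inv Λ n (by rw [hrank]; exact hn)
  have hmem : ∀ k : Fin 3 → ℤ, (fun j => (k j : ℝ)) ∈ Λ := by
    intro k
    refine (B.mem_span_iff_repr_mem ℤ _).2 fun i => ?_
    exact ⟨k i, by simp [B]⟩
  let ι : (Fin 3 → ℤ) → Λ := fun k => ⟨fun j => (k j : ℝ), hmem k⟩
  have hι : Function.Injective ι := by
    intro k l hkl
    ext j
    have := congrFun (congrArg Subtype.val hkl) j
    simpa [ι] using this
  refine (hs.comp_injective hι).congr fun k => ?_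
  have : ‖ι k‖ = ‖k‖ := by
    change ‖(fun j => (k j : ℝ))‖ = ‖k‖
    simp only [Pi.norm_def]
    congr 2
  simp only [Function.comp_apply, this]

lemma tsum_inv_freqWeight_pow_ne_top {n : ℕ} (hn : 3 < n) :
    ∑' k, (freqWeight k)⁻¹ ^ n ≠ ⊤ := by
  -- Since `0⁻¹ = 0`, the lattice sum misses the term at the origin; the indicator restores it.
  have hs : Summable fun k : Fin 3 → ℤ => ‖k‖⁻¹ ^ n + if k = 0 then (1 : ℝ) else 0 :=
    (summable_norm_inv_pow hn).add
      (summable_of_ne_finset_zero (s := {0}) fun k hk => by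
        rw [if_neg (by simpa using hk)])
  have hs' := hs.tsum_ofReal_ne_top
  refine ne_top_of_le_ne_top hs' (ENNReal.tsum_le_tsum fun k => ?_)
  rw [freqWeight, ← ENNReal.ofReal_inv_of_pos (by positivity), ← ENNReal.ofReal_pow (by positivity)]
  apply ENNReal.ofReal_le_ofReal
  rcases eq_or_ne k 0 with rfl | hk
  · rw [if_pos rfl]
    simp
  · rw [if_neg hk, add_zero]
    have : 0 < ‖k‖ := norm_pos_iff.2 hk
    gcongr
    linarith

/-- The balanced remainder is at most `N/2`, hence at most half of `N |q|` as soon as the quotient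
`q` is nonzero. -/
lemma mul_natAbs_bdiv_le {N : ℕ} (hN : 0 < N) (m : ℤ) : (N : ℤ) * |m.bdiv N| ≤ 2 * |m| := by
  have h1 := Int.bmod_add_bdiv m N
  have h2 := Int.le_bmod (x := m) hN
  have h3 := Int.bmod_le (x := m) hN
  have hb : 2 * |m.bmod N| ≤ N := by
    rw [← abs_of_pos (two_pos : (0 : ℤ) < 2), ← abs_mul, abs_le]
    constructor <;> omega
  have hm : (N : ℤ) * |m.bdiv N| ≤ |m| + |m.bmod N| := by
    have : (N : ℤ) * |m.bdiv N| = |m - m.bmod N| := by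
      rw [show m - m.bmod N = N * m.bdiv N by linarith, abs_mul, Nat.abs_cast]
    rw [this]
    exact abs_sub _ _
  rcases eq_or_ne (m.bdiv N) 0 with h0 | h0
  · rw [h0]
    simp
  · have : 1 ≤ |m.bdiv N| := Int.one_le_abs h0
    nlinarith

lemma mul_norm_bdiv_le {N : ℕ} (hN : 0 < N) (k : Fin 3 → ℤ) :
    (N : ℝ) * ‖fun j => (k j).bdiv N‖ ≤ 2 * ‖k‖ := by
  have hN' : (0 : ℝ) < N := by exact_mod_cast hN
  rw [mul_comm, ← le_div_iff₀ hN', pi_norm_le_iff_of_nonneg (by positivity)]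
  intro j
  rw [le_div_iff₀ hN', mul_comm]
  refine le_trans ?_ (mul_le_mul_of_nonneg_left (norm_le_pi_norm k j) zero_le_two)
  rw [Int.norm_eq_abs, Int.norm_eq_abs]
  exact_mod_cast mul_natAbs_bdiv_le hN (k j)

/-- Within one residue class modulo `N`, a frequency is determined by its balanced quotient.
Reindexing by quotients therefore compares the sum over the class with the full lattice sum, at the
cost of `c ^ n`. -/
lemma tsum_inv_freqWeight_pow_residue_le {N : ℕ} (k : Fin 3 → ℤ) (n : ℕ)
    {c : ℝ≥0∞} (hc0 : c ≠ 0) (hc : c ≠ ⊤) {P : (Fin 3 → ℤ) → Prop}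
    [DecidablePred P]
    (hP : ∀ l, P l → ∀ j, (N : ℤ) ∣ (k + l) j)
    (hw : ∀ l, P l → freqWeight (fun j => (l j).bdiv N) ≤ c * freqWeight l) :
    ∑' l, (if P l then (freqWeight l)⁻¹ ^ n else 0) ≤ c ^ n * ∑' p, (freqWeight p)⁻¹ ^ n := by
  have h1 : ∑' l, (if P l then (freqWeight l)⁻¹ ^ n else 0) =
      ∑' l : {l | P l}, (freqWeight l)⁻¹ ^ n := by
    rw [tsum_subtype {l | P l} fun l => (freqWeight l)⁻¹ ^ n]
    refine tsum_congr fun l => ?_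
    rw [Set.indicator_apply]
    rfl
  have hinj : Function.Injective fun l : {l | P l} => fun j => ((l : Fin 3 → ℤ) j).bdiv N := by
    rintro ⟨l, hl⟩ ⟨l', hl'⟩ h
    ext j
    have hq : (l j).bdiv N = (l' j).bdiv N := congrFun h j
    have hr : (l j).bmod N = (l' j).bmod N := by
      rw [Int.bmod_eq_bmod_iff_bmod_sub_eq_zero, ← Int.dvd_iff_bmod_eq_zero]
      have := dvd_sub (hP l hl j) (hP l' hl' j)
      simpa using this
    change l j = l' j
    rw [← Int.bmod_add_bdiv (l j) N, ← Int.bmod_add_bdiv (l' j) N, hq, hr]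
  rw [h1, ← ENNReal.tsum_mul_left]
  calc ∑' l : {l | P l}, (freqWeight l)⁻¹ ^ n
      ≤ ∑' l : {l | P l}, c ^ n * (freqWeight fun j => ((l : Fin 3 → ℤ) j).bdiv N)⁻¹ ^ n := by
        refine ENNReal.tsum_le_tsum fun l => ?_
        rw [← mul_pow]
        gcongr
        have := ENNReal.inv_le_inv.2 (hw l l.2)
        rw [ENNReal.mul_inv (Or.inl hc0) (Or.inl hc)] at this
        calc (freqWeight l)⁻¹ = c * (c⁻¹ * (freqWeight l)⁻¹) := by
              rw [← mul_assoc, ENNReal.mul_inv_cancel hc0 hc, one_mul]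
          _ ≤ _ := by gcongr
    _ ≤ ∑' p, c ^ n * (freqWeight p)⁻¹ ^ n :=
        ENNReal.tsum_comp_le_tsum_of_injective hinj fun p => c ^ n * (freqWeight p)⁻¹ ^ n

lemma tsum_inv_freqWeight_pow_dvd_le {N : ℕ} (hN : 0 < N) (k : Fin 3 → ℤ) (n : ℕ) :
    ∑' l, (if ∀ j, (N : ℤ) ∣ (k + l) j then (freqWeight l)⁻¹ ^ n else 0) ≤
      2 ^ n * ∑' p, (freqWeight p)⁻¹ ^ n := by
  refine tsum_inv_freqWeight_pow_residue_le (P := fun l => ∀ j, (N : ℤ) ∣ (k + l) j) k n two_ne_zero ENNReal.ofNat_ne_top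
    (fun _ h => h) fun l _ => ?_
  have h1 := mul_norm_bdiv_le hN l
  have h2 : (1 : ℝ) ≤ N := by exact_mod_cast hN
  rw [freqWeight, freqWeight, ← ENNReal.ofReal_ofNat, ← ENNReal.ofReal_mul (by norm_num)]
  apply ENNReal.ofReal_le_ofReal
  nlinarith [norm_nonneg fun j => (l j).bdiv N]

open Classical in
lemma tsum_inv_freqWeight_pow_high_le {N : ℕ} (hN : 0 < N) (k : Fin 3 → ℤ) (n : ℕ) :
    ∑' l, (if (∀ j, (N : ℤ) ∣ (k + l) j) ∧ (N : ℝ) ≤ 2 * ‖l‖ then (freqWeight l)⁻¹ ^ n else 0) ≤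
      ENNReal.ofReal (4 / N) ^ n * ∑' p, (freqWeight p)⁻¹ ^ n := by
  have hN' : (0 : ℝ) < N := by exact_mod_cast hN
  refine tsum_inv_freqWeight_pow_residue_le
    (P := fun l => (∀ j, (N : ℤ) ∣ (k + l) j) ∧ (N : ℝ) ≤ 2 * ‖l‖) k n ?_ ENNReal.ofReal_ne_top
    (fun _ h => h.1) fun l hl => ?_
  · rw [Ne, ENNReal.ofReal_eq_zero, not_le]
    positivity
  have h1 := mul_norm_bdiv_le hN l
  rw [freqWeight, freqWeight, ← ENNReal.ofReal_mul (by positivity)]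
  apply ENNReal.ofReal_le_ofReal
  -- With `q` the quotient, `N(1 + ‖q‖) ≤ N + 2‖l‖ ≤ 4‖l‖`, where the last inequality uses that `l`
  -- is high.
  rw [div_mul_eq_mul_div, le_div_iff₀ hN']
  nlinarith [hl.2]

/-! ### The aliasing sum -/

/-- Cauchy-Schwarz, as Hölder's inequality for the counting measure. -/
lemma tsum_mul_sq_le {ι : Type*} (f g : ι → ℝ≥0∞) :
    (∑' i, f i * g i) ^ 2 ≤ (∑' i, f i ^ 2) * ∑' i, g i ^ 2 := by
  let : MeasurableSpace ι := ⊤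
  have h := ENNReal.lintegral_mul_le_Lp_mul_Lq (Measure.count : Measure ι)
    Real.HolderConjugate.two_two (measurable_from_top (f := f)).aemeasurable
    (measurable_from_top (f := g)).aemeasurable
  simp only [lintegral_count, Pi.mul_apply, ENNReal.rpow_two] at h
  calc (∑' i, f i * g i) ^ 2
      ≤ ((∑' i, f i ^ 2) ^ (1 / 2 : ℝ) * (∑' i, g i ^ 2) ^ (1 / 2 : ℝ)) ^ 2 := by gcongr
    _ = _ := by
      rw [mul_pow, ← ENNReal.rpow_natCast, ← ENNReal.rpow_natCast, ← ENNReal.rpow_mul,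
        ← ENNReal.rpow_mul]
      norm_num

/-- The squared weighted `ℓ²` norm `∑ (1 + ‖k‖)^{2m} |a k|²`. -/
def weightedSq (m : ℕ) (a : (Fin 3 → ℤ) → ℂ) : ℝ≥0∞ :=
  ∑' k, freqWeight k ^ (2 * m) * ‖a k‖ₑ ^ 2

lemma weightedSq_mono {m n : ℕ} (hmn : m ≤ n) (a : (Fin 3 → ℤ) → ℂ) :
    weightedSq m a ≤ weightedSq n a := by
  refine ENNReal.tsum_le_tsum fun k => ?_
  gcongr
  exact one_le_freqWeight k

/-- The constant of the aliasing estimate. -/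
def aliasConst : ℝ≥0∞ :=
  (2 ^ 4 * ∑' p, (freqWeight p)⁻¹ ^ 4) * ∑' p, (freqWeight p)⁻¹ ^ 16

lemma aliasConst_ne_top : aliasConst ≠ ⊤ :=
  ENNReal.mul_ne_top (ENNReal.mul_ne_top (by simp) (tsum_inv_freqWeight_pow_ne_top (by norm_num)))
    (tsum_inv_freqWeight_pow_ne_top (by norm_num))

open Classical in
lemma tsum_alias_high_sq_le {N : ℕ} (hN : 0 < N) (a b : (Fin 3 → ℤ) → ℂ) :
    (∑' p : (Fin 3 → ℤ) × (Fin 3 → ℤ),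
      if (∀ j, (N : ℤ) ∣ (p.1 + p.2) j) ∧ (N : ℝ) ≤ 2 * ‖p.1‖ then ‖a p.1‖ₑ * ‖b p.2‖ₑ else 0) ^ 2 ≤
      aliasConst * ENNReal.ofReal (4 / N) ^ 16 * (weightedSq 8 a * weightedSq 2 b) := by
  set P : (Fin 3 → ℤ) → (Fin 3 → ℤ) → Prop := fun k l =>
    (∀ j, (N : ℤ) ∣ (k + l) j) ∧ (N : ℝ) ≤ 2 * ‖k‖
  -- Each factor carries the growing weight of one index and the decaying weight of the other, so
  -- that summing over the other index first leaves a weighted `ℓ²` norm.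
  let F : (Fin 3 → ℤ) × (Fin 3 → ℤ) → ℝ≥0∞ := fun p =>
    if P p.1 p.2 then freqWeight p.1 ^ 8 * ‖a p.1‖ₑ * (freqWeight p.2)⁻¹ ^ 2 else 0
  let G : (Fin 3 → ℤ) × (Fin 3 → ℤ) → ℝ≥0∞ := fun p =>
    if P p.1 p.2 then freqWeight p.2 ^ 2 * ‖b p.2‖ₑ * (freqWeight p.1)⁻¹ ^ 8 else 0
  have hFG : ∀ p, (if P p.1 p.2 then ‖a p.1‖ₑ * ‖b p.2‖ₑ else 0) = F p * G p := by
    intro p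
    by_cases hp : P p.1 p.2
    · simp only [F, G, if_pos hp]
      have h1 : freqWeight p.1 ^ 8 * (freqWeight p.1)⁻¹ ^ 8 = 1 := by
        rw [← mul_pow, ENNReal.mul_inv_cancel (freqWeight_ne_zero _) (freqWeight_ne_top _), one_pow]
      have h2 : freqWeight p.2 ^ 2 * (freqWeight p.2)⁻¹ ^ 2 = 1 := by
        rw [← mul_pow, ENNReal.mul_inv_cancel (freqWeight_ne_zero _) (freqWeight_ne_top _), one_pow]
      calc ‖a p.1‖ₑ * ‖b p.2‖ₑ = (freqWeight p.1 ^ 8 * (freqWeight p.1)⁻¹ ^ 8) *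
            (freqWeight p.2 ^ 2 * (freqWeight p.2)⁻¹ ^ 2) * (‖a p.1‖ₑ * ‖b p.2‖ₑ) := by
              rw [h1, h2, one_mul, one_mul]
        _ = _ := by ring
    · simp only [F, G, if_neg hp, mul_zero]
  have hF : ∑' p, F p ^ 2 ≤ weightedSq 8 a * (2 ^ 4 * ∑' p, (freqWeight p)⁻¹ ^ 4) := by
    rw [ENNReal.tsum_prod', weightedSq, ← ENNReal.tsum_mul_right]
    refine ENNReal.tsum_le_tsum fun k => ?_
    refine le_trans ?_ (mul_le_mul_right (tsum_inv_freqWeight_pow_dvd_le hN k 4) _)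
    rw [← ENNReal.tsum_mul_left]
    refine ENNReal.tsum_le_tsum fun l => ?_
    by_cases hp : P k l
    · simp only [F, if_pos hp, if_pos hp.1]
      exact le_of_eq (by ring)
    · simp [F, if_neg hp]
  have hG : ∑' p, G p ^ 2 ≤
      weightedSq 2 b * (ENNReal.ofReal (4 / N) ^ 16 * ∑' p, (freqWeight p)⁻¹ ^ 16) := by
    -- Here the inner sum must run over the high frequency `k`, which produces the factor `(4/N)¹⁶`.
    rw [ENNReal.tsum_prod', ENNReal.tsum_comm, weightedSq, ← ENNReal.tsum_mul_right]
    refine ENNReal.tsum_le_tsum fun l => ?_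
    refine le_trans ?_ (mul_le_mul_right (tsum_inv_freqWeight_pow_high_le hN l 16) _)
    rw [← ENNReal.tsum_mul_left]
    refine ENNReal.tsum_le_tsum fun k => ?_
    by_cases hp : P k l
    · have hp' : (∀ j, (N : ℤ) ∣ (l + k) j) ∧ (N : ℝ) ≤ 2 * ‖k‖ := by
        rw [add_comm]
        exact hp
      simp only [G, if_pos hp, if_pos hp']
      exact le_of_eq (by ring)
    · simp [G, if_neg hp]
  calc (∑' p : (Fin 3 → ℤ) × (Fin 3 → ℤ), if P p.1 p.2 then ‖a p.1‖ₑ * ‖b p.2‖ₑ else 0) ^ 2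
      = (∑' p, F p * G p) ^ 2 := by rw [tsum_congr hFG]
    _ ≤ (∑' p, F p ^ 2) * ∑' p, G p ^ 2 := tsum_mul_sq_le F G
    _ ≤ _ := mul_le_mul' hF hG
    _ = _ := by
      rw [aliasConst]
      ring

/-- Square-summability against the weight `(1 + ‖k‖)^4` implies absolute summability. -/
lemma summable_norm_of_weightedSq_ne_top {a : (Fin 3 → ℤ) → ℂ} (ha : weightedSq 2 a ≠ ⊤) :
    Summable fun k => ‖a k‖ := by
  have h := tsum_mul_sq_le (fun k => (freqWeight k)⁻¹ ^ 2) fun k => freqWeight k ^ 2 * ‖a k‖ₑ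
  have h1 : ∀ k, (freqWeight k)⁻¹ ^ 2 * (freqWeight k ^ 2 * ‖a k‖ₑ) = ‖a k‖ₑ := fun k => by
    rw [← mul_assoc, ← mul_pow, ENNReal.inv_mul_cancel (freqWeight_ne_zero _) (freqWeight_ne_top _),
      one_pow, one_mul]
  simp only [h1, ← pow_mul, mul_pow] at h
  have hfin : (∑' k, ‖a k‖ₑ) ^ 2 ≠ ⊤ :=
    ne_top_of_le_ne_top
      (ENNReal.mul_ne_top (tsum_inv_freqWeight_pow_ne_top (by norm_num)) ha) h
  have hfin' : ∑' k, ‖a k‖ₑ ≠ ⊤ := fun h => hfin (by simp [h])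
  simp only [← ofReal_norm] at hfin'
  have := ENNReal.summable_toReal hfin'
  simpa using this


/-! ### Fourier coefficients and Bessel's inequality -/

/-- The Fourier coefficient `L⁻³ ∫_Ω f e_{-k}`. -/
def fourierCoeffCell (L : ℝ) (f : (Fin 3 → ℝ) → ℂ) (k : Fin 3 → ℤ) : ℂ :=
  ((L : ℂ) ^ 3)⁻¹ * ∫ x in cell L, f x * fourierMode L (-k) x

lemma measurableSet_cell (L : ℝ) : MeasurableSet (cell L) :=
  MeasurableSet.univ_pi fun _ => measurableSet_Ioo

lemma isOpen_cell (L : ℝ) : IsOpen (cell L) :=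
  isOpen_set_pi Set.finite_univ fun _ _ => isOpen_Ioo

lemma cell_subset_Icc (L : ℝ) : cell L ⊆ Set.Icc (fun _ => 0) fun _ => L := fun _ hx =>
  ⟨fun j => (hx j trivial).1.le, fun j => (hx j trivial).2.le⟩

lemma integrable_cell_of_continuous {E : Type*} [NormedAddCommGroup E] (L : ℝ)
    {f : (Fin 3 → ℝ) → E} (hf : Continuous f) :
    Integrable f (volume.restrict (cell L)) :=
  (hf.continuousOn.integrableOn_compact isCompact_Icc).mono_set (cell_subset_Icc L)

lemma memLp_fourierMode (L : ℝ) (k : Fin 3 → ℤ) (c : ℂ) :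
    MemLp (fun x => c * fourierMode L k x) 2 (volume.restrict (cell L)) :=
  MemLp.of_bound (by fun_prop) ‖c‖ (by simp [norm_fourierMode])

/-- The normalized Fourier modes in `L²(Ω)`. -/
def fourierModeLp (L : ℝ) (k : Fin 3 → ℤ) : Lp ℂ 2 ((volume : Measure (Fin 3 → ℝ)).restrict (cell L)) :=
  (memLp_fourierMode L k ((√(L ^ 3) : ℝ) : ℂ)⁻¹).toLp _

lemma orthonormal_fourierModeLp {L : ℝ} (hL : 0 < L) : Orthonormal ℂ (fourierModeLp L) := by
  have hL' : (L : ℂ) ≠ 0 := by exact_mod_cast hL.ne'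
  classical
  rw [orthonormal_iff_ite]
  intro k l
  rw [L2.inner_def]
  have h1 : (fun x => inner ℂ (fourierModeLp L k x) (fourierModeLp L l x))
      =ᵐ[volume.restrict (cell L)] fun x => ((L : ℂ) ^ 3)⁻¹ * fourierMode L (l - k) x := by
    filter_upwards [(memLp_fourierMode L k ((√(L ^ 3) : ℝ) : ℂ)⁻¹).coeFn_toLp,
      (memLp_fourierMode L l ((√(L ^ 3) : ℝ) : ℂ)⁻¹).coeFn_toLp] with x hk hl
    rw [fourierModeLp, fourierModeLp, hk, hl, RCLike.inner_apply, map_mul, conj_fourierMode,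
      sub_eq_add_neg, fourierMode_add]
    have h2 : (((√(L ^ 3) : ℝ) : ℂ)⁻¹) * (starRingEnd ℂ) (((√(L ^ 3) : ℝ) : ℂ)⁻¹) =
        ((L : ℂ) ^ 3)⁻¹ := by
      rw [map_inv₀, Complex.conj_ofReal, ← mul_inv, ← Complex.ofReal_mul,
        Real.mul_self_sqrt (by positivity)]
      push_cast
      rfl
    rw [← h2]
    ring
  rw [integral_congr_ae h1, integral_const_mul, integral_fourierMode hL]
  simp only [sub_eq_zero, eq_comm (a := l) (b := k)]
  split_ifs
  · field_simp
  · simp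

/-- Bessel's inequality for the modes normalized by `L^{-3/2}`; the coefficients carry `L⁻³`
instead, which accounts for the constant. -/
lemma tsum_fourierCoeffCell_sq_le {L : ℝ} (hL : 0 < L) {v : (Fin 3 → ℝ) → ℂ}
    (hv : MemLp v 2 (volume.restrict (cell L))) :
    ∑' k, ‖fourierCoeffCell L v k‖ₑ ^ 2 ≤
      ENNReal.ofReal (L ^ 3)⁻¹ * eLpNorm v 2 (volume.restrict (cell L)) ^ 2 := by
  have hL' : (L : ℂ) ≠ 0 := by exact_mod_cast hL.ne'
  have hc : ∀ k, ‖fourierCoeffCell L v k‖ ^ 2 =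
      (L ^ 3)⁻¹ * ‖inner ℂ (fourierModeLp L k) (hv.toLp v)‖ ^ 2 := by
    intro k
    have h1 : inner ℂ (fourierModeLp L k) (hv.toLp v) =
        ((√(L ^ 3) : ℝ) : ℂ)⁻¹ * ∫ x in cell L, v x * fourierMode L (-k) x := by
      rw [L2.inner_def, ← integral_const_mul]
      refine integral_congr_ae ?_
      filter_upwards [(memLp_fourierMode L k ((√(L ^ 3) : ℝ) : ℂ)⁻¹).coeFn_toLp,
        hv.coeFn_toLp] with x hk hl
      rw [fourierModeLp, hk, hl, RCLike.inner_apply, map_mul, conj_fourierMode, map_inv₀,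
        Complex.conj_ofReal]
      ring
    rw [h1, fourierCoeffCell, norm_mul, norm_mul, mul_pow, mul_pow, norm_inv, norm_inv, norm_pow,
      Complex.norm_real, Complex.norm_real, Real.norm_of_nonneg hL.le,
      Real.norm_of_nonneg (Real.sqrt_nonneg _), inv_pow (√(L ^ 3)), Real.sq_sqrt (by positivity)]
    ring
  have hB := (orthonormal_fourierModeLp hL).tsum_inner_products_le (hv.toLp v)
  have hS := (orthonormal_fourierModeLp hL).inner_products_summable (hv.toLp v)
  have hn : eLpNorm v 2 (volume.restrict (cell L)) ^ 2 = ENNReal.ofReal (‖hv.toLp v‖ ^ 2) := by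
    rw [Lp.norm_toLp, ENNReal.ofReal_pow ENNReal.toReal_nonneg,
      ENNReal.ofReal_toReal hv.eLpNorm_ne_top]
  have he : ∀ k, ‖fourierCoeffCell L v k‖ₑ ^ 2 = ENNReal.ofReal (L ^ 3)⁻¹ *
      ENNReal.ofReal (‖inner ℂ (fourierModeLp L k) (hv.toLp v)‖ ^ 2) := by
    intro k
    rw [← ofReal_norm, ← ENNReal.ofReal_pow (norm_nonneg _), hc,
      ENNReal.ofReal_mul (by positivity)]
  rw [tsum_congr he, ENNReal.tsum_mul_left, hn,
    ← ENNReal.ofReal_tsum_of_nonneg (fun k => by positivity) hS]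
  gcongr

/-! ### Sobolev norms bound weighted Fourier coefficients -/

/-- The linear phase of a Fourier mode. -/
def fourierPhase (L : ℝ) (k : Fin 3 → ℤ) : (Fin 3 → ℝ) →L[ℝ] ℂ :=
  ∑ j, (2 * (Real.pi : ℂ) * Complex.I * (k j : ℂ) / (L : ℂ)) •
    (Complex.ofRealCLM.comp (ContinuousLinearMap.proj j))

lemma fourierMode_eq_exp_phase (L : ℝ) (k : Fin 3 → ℤ) :
    fourierMode L k = fun x => Complex.exp (fourierPhase L k x) := by
  ext x
  rw [fourierMode, Finset.mul_sum, Finset.sum_div, fourierPhase, sum_apply]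
  congr 1
  refine Finset.sum_congr rfl fun j _ => ?_
  simp
  ring

lemma fourierPhase_single (L : ℝ) (k : Fin 3 → ℤ) (j : Fin 3) :
    fourierPhase L k (Pi.single j 1) = 2 * (Real.pi : ℂ) * Complex.I * (k j : ℂ) / (L : ℂ) := by
  rw [fourierPhase, sum_apply, Finset.sum_eq_single j]
  · simp
  · intro i _ hi
    simp [Pi.single_eq_of_ne hi]
  · simp

lemma contDiff_re_fourierMode (L : ℝ) (k : Fin 3 → ℤ) (c : ℂ) :
    ContDiff ℝ ∞ fun x => (c * fourierMode L k x).re := by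
  rw [fourierMode_eq_exp_phase]
  exact Complex.reCLM.contDiff.comp (contDiff_const.mul (fourierPhase L k).contDiff.cexp)

lemma partialDeriv_re_fourierMode (L : ℝ) (k : Fin 3 → ℤ) (c : ℂ) (j : Fin 3) :
    partialDeriv j (fun x => (c * fourierMode L k x).re) =
      fun x => (c * (2 * (Real.pi : ℂ) * Complex.I * (k j : ℂ) / (L : ℂ)) * fourierMode L k x).re := by
  ext x
  rw [partialDeriv, fourierMode_eq_exp_phase]
  have h1 : HasFDerivAt (fun x => c * Complex.exp (fourierPhase L k x))
      (c • (Complex.exp (fourierPhase L k x) • fourierPhase L k)) x :=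
    (fourierPhase L k).hasFDerivAt.cexp.const_mul c
  have h2 : HasFDerivAt (fun x => (c * Complex.exp (fourierPhase L k x)).re)
      (Complex.reCLM.comp (c • (Complex.exp (fourierPhase L k x) • fourierPhase L k))) x :=
    Complex.reCLM.hasFDerivAt.comp x h1
  rw [h2.fderiv, ContinuousLinearMap.comp_apply, smul_apply,
    smul_apply, fourierPhase_single, Complex.reCLM_apply, smul_eq_mul,
    smul_eq_mul]
  congr 1
  ring

lemma multiDeriv_single_re_fourierMode (L : ℝ) (k : Fin 3 → ℤ) (c : ℂ) (j : Fin 3) (m : ℕ) :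
    multiDeriv (Pi.single j m) (fun x => (c * fourierMode L k x).re) =
      fun x => (c * (2 * (Real.pi : ℂ) * Complex.I * (k j : ℂ) / (L : ℂ)) ^ m *
        fourierMode L k x).re := by
  have h : multiDeriv (Pi.single j m) (fun x => (c * fourierMode L k x).re) =
      (partialDeriv j)^[m] fun x => (c * fourierMode L k x).re := by
    fin_cases j <;> simp [multiDeriv]
  rw [h]
  induction m with
  | zero => simp
  | succ m ih =>
    have ih' := ih (by fin_cases j <;> simp [multiDeriv])
    rw [Function.iterate_succ_apply', ih', partialDeriv_re_fourierMode]
    ext x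
    congr 1
    ring

lemma isPeriodic_re_fourierMode {L : ℝ} (hL : L ≠ 0) (k : Fin 3 → ℤ) (c : ℂ) :
    IsPeriodic L fun x => (c * fourierMode L k x).re := fun j x => by
  simp only [fourierMode_periodic hL k j x]

/-- Test functions are real, so the weak identity is tested on `Re (c e_k)`; `c = 1` and `c = -i`
recover the real and imaginary parts. -/
lemma integral_mul_fourierMode_of_isWeakDeriv {L : ℝ} (hL : L ≠ 0) {f v : (Fin 3 → ℝ) → ℝ}
    (hf : Continuous f) {j : Fin 3} {m : ℕ} (hv : IsWeakDeriv L (Pi.single j m) f v)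
    (k : Fin 3 → ℤ) :
    (2 * (Real.pi : ℂ) * Complex.I * (k j : ℂ) / (L : ℂ)) ^ m *
        ∫ x in cell L, (f x : ℂ) * fourierMode L k x =
      (-1) ^ m * ∫ x in cell L, (v x : ℂ) * fourierMode L k x := by
  set θ : ℂ := 2 * (Real.pi : ℂ) * Complex.I * (k j : ℂ) / (L : ℂ)
  have hvi : Integrable (fun x => (v x : ℂ)) (volume.restrict (cell L)) :=
    (hv.memLp.integrable one_le_two).ofReal
  have hvi' : Integrable (fun x => (v x : ℂ) * fourierMode L k x) (volume.restrict (cell L)) :=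
    hvi.mul_bdd (c := 1) (by fun_prop) (by simp [norm_fourierMode])
  have hre : ∀ c : ℂ, (c * (θ ^ m * ∫ x in cell L, (f x : ℂ) * fourierMode L k x)).re =
      (c * ((-1) ^ m * ∫ x in cell L, (v x : ℂ) * fourierMode L k x)).re := by
    intro c
    have h := hv.integral_eq _ (contDiff_re_fourierMode L k c) (isPeriodic_re_fourierMode hL k c)
    rw [multiDeriv_single_re_fourierMode, Finset.sum_pi_single' j m Finset.univ,
      if_pos (Finset.mem_univ j)] at h
    have h1 : (c * (θ ^ m * ∫ x in cell L, (f x : ℂ) * fourierMode L k x)).re =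
        ∫ x in cell L, f x * (c * θ ^ m * fourierMode L k x).re := by
      rw [← mul_assoc, ← integral_const_mul, ← Complex.reCLM_apply,
        ← ContinuousLinearMap.integral_comp_comm _
          (integrable_cell_of_continuous L (by fun_prop))]
      refine integral_congr_ae (Filter.Eventually.of_forall fun x => ?_)
      simp only [Complex.reCLM_apply]
      rw [← Complex.re_ofReal_mul]
      congr 1
      ring
    have h2 : (c * ((-1) ^ m * ∫ x in cell L, (v x : ℂ) * fourierMode L k x)).re =
        (-1) ^ m * ∫ x in cell L, v x * (c * fourierMode L k x).re := by
      have : c * ((-1) ^ m * ∫ x in cell L, (v x : ℂ) * fourierMode L k x) =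
          (((-1) ^ m : ℝ) : ℂ) * (c * ∫ x in cell L, (v x : ℂ) * fourierMode L k x) := by
        push_cast
        ring
      rw [this, Complex.re_ofReal_mul, ← integral_const_mul, ← Complex.reCLM_apply,
        ← ContinuousLinearMap.integral_comp_comm _ (hvi'.const_mul c)]
      congr 1
      refine integral_congr_ae (Filter.Eventually.of_forall fun x => ?_)
      simp only [Complex.reCLM_apply]
      rw [← Complex.re_ofReal_mul]
      congr 1
      ring
    rw [h1, h2, h]
  apply Complex.ext
  · simpa using hre 1
  · have h := hre (-Complex.I)
    simpa only [neg_mul, Complex.neg_re, Complex.I_mul_re, neg_neg] using h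

lemma norm_pow_mul_fourierCoeffCell {L : ℝ} (hL : 0 < L) {f v : (Fin 3 → ℝ) → ℝ}
    (hf : Continuous f) {j : Fin 3} {m : ℕ} (hv : IsWeakDeriv L (Pi.single j m) f v)
    (k : Fin 3 → ℤ) :
    ‖k j‖ ^ m * ‖fourierCoeffCell L (fun x => (f x : ℂ)) k‖ =
      (L / (2 * Real.pi)) ^ m * ‖fourierCoeffCell L (fun x => (v x : ℂ)) k‖ := by
  have h := congrArg norm (integral_mul_fourierMode_of_isWeakDeriv hL.ne' hf hv (-k))
  simp only [norm_mul, norm_pow, norm_neg, norm_one, one_pow, one_mul, norm_div, Pi.neg_apply,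
    Int.cast_neg, Complex.norm_I, mul_one, Complex.norm_real, Real.norm_of_nonneg hL.le,
    Real.norm_of_nonneg Real.pi_pos.le, Complex.norm_ofNat, Complex.norm_intCast] at h
  have hpi := Real.pi_pos
  have hk : |(k j : ℝ)| ^ m = (L / (2 * Real.pi)) ^ m * (2 * Real.pi * |(k j : ℝ)| / L) ^ m := by
    rw [← mul_pow]
    congr 1
    field_simp
  rw [fourierCoeffCell, fourierCoeffCell, norm_mul, norm_mul, ← h, Int.norm_eq_abs, hk]
  ring

/-- The sup norm is attained at a coordinate, so pure derivatives `∂_j^m` together with order zero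
control the full weight. -/
lemma one_add_norm_pow_le (k : Fin 3 → ℤ) (m : ℕ) :
    (1 + ‖k‖) ^ (2 * m) ≤ 2 ^ (2 * m) * (1 + ∑ j, (‖k j‖ ^ m) ^ 2) := by
  obtain ⟨j, hj⟩ : ∃ j, ‖k‖ ≤ ‖k j‖ := by
    obtain ⟨j, -, hj⟩ := Finset.exists_mem_eq_sup Finset.univ Finset.univ_nonempty
      fun j => ‖k j‖₊
    exact ⟨j, by rw [Pi.norm_def, hj]; rfl⟩
  have hs : (‖k j‖ ^ m) ^ 2 ≤ ∑ j, (‖k j‖ ^ m) ^ 2 :=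
    Finset.single_le_sum (f := fun j => (‖k j‖ ^ m) ^ 2) (fun _ _ => by positivity)
      (Finset.mem_univ j)
  rcases le_total ‖k‖ 1 with h | h
  · calc (1 + ‖k‖) ^ (2 * m) ≤ 2 ^ (2 * m) := by gcongr; linarith
      _ ≤ _ := le_mul_of_one_le_right (by positivity) (by linarith [sq_nonneg (‖k j‖ ^ m)])
  · calc (1 + ‖k‖) ^ (2 * m) ≤ (2 * ‖k j‖) ^ (2 * m) := by gcongr; linarith
      _ = 2 ^ (2 * m) * (‖k j‖ ^ m) ^ 2 := by ring
      _ ≤ _ := by gcongr; linarith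

/-- The constant comparing the weighted Fourier coefficients with the Sobolev norm. -/
def sobolevConst (L : ℝ) (m : ℕ) : ℝ :=
  2 ^ (2 * m) * ((L ^ 3)⁻¹ * (1 + 3 * ((L / (2 * Real.pi)) ^ m) ^ 2))

lemma sobolevConst_pos {L : ℝ} (hL : 0 < L) (m : ℕ) : 0 < sobolevConst L m := by
  rw [sobolevConst]
  positivity

lemma zero_mem_multiIndices (m : ℕ) : (0 : Fin 3 → ℕ) ∈ multiIndices m := by
  simp [multiIndices]

lemma single_mem_multiIndices (j : Fin 3) (m : ℕ) : Pi.single j m ∈ multiIndices m := by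
  rw [multiIndices, Finset.mem_filter, Fintype.mem_piFinset]
  refine ⟨fun i => ?_, ?_⟩
  · rw [Finset.mem_range, Nat.lt_succ_iff]
    rcases eq_or_ne i j with rfl | h
    · rw [Pi.single_eq_same]
    · rw [Pi.single_eq_of_ne h]
      exact Nat.zero_le m
  · rw [Finset.sum_pi_single', if_pos (Finset.mem_univ j)]

lemma weightedSq_le_sum {L : ℝ} (hL : 0 < L) {f : (Fin 3 → ℝ) → ℝ} (hf : Continuous f) {m : ℕ}
    {v : (Fin 3 → ℕ) → (Fin 3 → ℝ) → ℝ} (hv : ∀ α ∈ multiIndices m, IsWeakDeriv L α f (v α)) :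
    weightedSq m (fourierCoeffCell L fun x => (f x : ℂ)) ≤ ENNReal.ofReal (sobolevConst L m) *
      ∑ α ∈ multiIndices m, eLpNorm (v α) 2 (volume.restrict (cell L)) ^ 2 := by
  set S : ℝ≥0∞ := ∑ α ∈ multiIndices m, eLpNorm (v α) 2 (volume.restrict (cell L)) ^ 2
  set a := fourierCoeffCell L fun x => (f x : ℂ)
  have hbessel : ∀ α ∈ multiIndices m,
      ∑' k, ‖fourierCoeffCell L (fun x => (v α x : ℂ)) k‖ₑ ^ 2 ≤ ENNReal.ofReal (L ^ 3)⁻¹ * S := by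
    intro α hα
    have hm : MemLp (fun x => (v α x : ℂ)) 2 (volume.restrict (cell L)) := (hv α hα).memLp.ofReal
    refine (tsum_fourierCoeffCell_sq_le hL hm).trans ?_
    gcongr
    have : eLpNorm (fun x => (v α x : ℂ)) 2 (volume.restrict (cell L)) =
        eLpNorm (v α) 2 (volume.restrict (cell L)) :=
      eLpNorm_congr_norm_ae (Filter.Eventually.of_forall fun x => by simp)
    rw [this]
    exact Finset.single_le_sum
      (f := fun α => eLpNorm (v α) 2 (volume.restrict (cell L)) ^ 2) (fun _ _ => zero_le) hα
  -- The weak derivative of order zero is not literally `f`, but it has Fourier coefficients of the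
  -- same size.
  have hzero : ∀ k, ‖a k‖ₑ = ‖fourierCoeffCell L (fun x => (v 0 x : ℂ)) k‖ₑ := by
    intro k
    have h0 : IsWeakDeriv L (Pi.single (0 : Fin 3) 0) f (v 0) := by
      rw [Pi.single_zero]
      exact hv 0 (zero_mem_multiIndices m)
    have := norm_pow_mul_fourierCoeffCell hL hf h0 k
    rw [pow_zero, pow_zero, one_mul, one_mul] at this
    rw [← ofReal_norm, ← ofReal_norm, this]
  set r : ℝ≥0∞ := ENNReal.ofReal ((L / (2 * Real.pi)) ^ m)
  have hterm : ∀ k, freqWeight k ^ (2 * m) * ‖a k‖ₑ ^ 2 ≤ 2 ^ (2 * m) *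
      (‖fourierCoeffCell L (fun x => (v 0 x : ℂ)) k‖ₑ ^ 2 + ∑ j, r ^ 2 *
        ‖fourierCoeffCell L (fun x => (v (Pi.single j m) x : ℂ)) k‖ₑ ^ 2) := by
    intro k
    have h1 : freqWeight k ^ (2 * m) ≤
        2 ^ (2 * m) * (1 + ∑ j, ENNReal.ofReal (‖k j‖ ^ m) ^ 2) := by
      rw [freqWeight, ← ENNReal.ofReal_pow (by positivity)]
      refine (ENNReal.ofReal_le_ofReal (one_add_norm_pow_le k m)).trans (le_of_eq ?_)
      rw [ENNReal.ofReal_mul (by positivity), ENNReal.ofReal_add (by norm_num) (by positivity),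
        ENNReal.ofReal_sum_of_nonneg (fun _ _ => by positivity), ENNReal.ofReal_one,
        ENNReal.ofReal_pow (by norm_num), ENNReal.ofReal_ofNat]
      congr 2
      exact Finset.sum_congr rfl fun j _ => ENNReal.ofReal_pow (by positivity) 2
    have h2 : ∀ j, ENNReal.ofReal (‖k j‖ ^ m) ^ 2 * ‖a k‖ₑ ^ 2 =
        r ^ 2 * ‖fourierCoeffCell L (fun x => (v (Pi.single j m) x : ℂ)) k‖ₑ ^ 2 := by
      intro j
      rw [← mul_pow, ← mul_pow, ← ofReal_norm, ← ofReal_norm, ← ENNReal.ofReal_mul (by positivity),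
        ← ENNReal.ofReal_mul (by positivity),
        norm_pow_mul_fourierCoeffCell hL hf (hv _ (single_mem_multiIndices j m)) k]
    calc freqWeight k ^ (2 * m) * ‖a k‖ₑ ^ 2
        ≤ 2 ^ (2 * m) * (1 + ∑ j, ENNReal.ofReal (‖k j‖ ^ m) ^ 2) * ‖a k‖ₑ ^ 2 := by gcongr
      _ = _ := by
        rw [mul_assoc, add_mul, one_mul, Finset.sum_mul, ← hzero, Finset.sum_congr rfl
          fun j _ => h2 j]
  calc weightedSq m a ≤ ∑' k, _ := ENNReal.tsum_le_tsum hterm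
    _ = 2 ^ (2 * m) * (∑' k, ‖fourierCoeffCell L (fun x => (v 0 x : ℂ)) k‖ₑ ^ 2 + ∑ j, r ^ 2 *
        ∑' k, ‖fourierCoeffCell L (fun x => (v (Pi.single j m) x : ℂ)) k‖ₑ ^ 2) := by
      rw [ENNReal.tsum_mul_left, ENNReal.tsum_add,
        Summable.tsum_finsetSum fun _ _ => ENNReal.summable]
      simp only [ENNReal.tsum_mul_left]
    _ ≤ 2 ^ (2 * m) * (ENNReal.ofReal (L ^ 3)⁻¹ * S +
        ∑ _j : Fin 3, r ^ 2 * (ENNReal.ofReal (L ^ 3)⁻¹ * S)) := by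
      gcongr with j
      · exact hbessel 0 (zero_mem_multiIndices m)
      · exact hbessel _ (single_mem_multiIndices j m)
    _ = ENNReal.ofReal (sobolevConst L m) * S := by
      rw [sobolevConst, ENNReal.ofReal_mul (by positivity), ENNReal.ofReal_mul (by positivity),
        ENNReal.ofReal_add (by norm_num) (by positivity), ENNReal.ofReal_mul (by norm_num),
        ENNReal.ofReal_pow (by positivity), ENNReal.ofReal_pow (by positivity), ENNReal.ofReal_one,
        ENNReal.ofReal_ofNat, ENNReal.ofReal_ofNat, Finset.sum_const, Finset.card_univ,
        Fintype.card_fin, nsmul_eq_mul]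
      push_cast
      ring

lemma weightedSq_le_sobolevNorm {L : ℝ} (hL : 0 < L) {f : (Fin 3 → ℝ) → ℝ} (hf : Continuous f)
    (m : ℕ) :
    weightedSq m (fourierCoeffCell L fun x => (f x : ℂ)) ≤
      ENNReal.ofReal (sobolevConst L m) * sobolevNorm L m f ^ 2 := by
  have hc0 : ENNReal.ofReal (sobolevConst L m) ≠ 0 := by
    rw [Ne, ENNReal.ofReal_eq_zero, not_le]
    exact sobolevConst_pos hL m
  set W := weightedSq m (fourierCoeffCell L fun x => (f x : ℂ))
  -- Isolating the norm lets the bound pass to the infimum, including the empty one, whose value is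
  -- `∞`.
  have h : ((ENNReal.ofReal (sobolevConst L m))⁻¹ * W) ^ (1 / 2 : ℝ) ≤ sobolevNorm L m f := by
    refine le_iInf₂ fun v hv => ENNReal.rpow_le_rpow ?_ (by norm_num)
    rw [ENNReal.inv_mul_le_iff hc0 ENNReal.ofReal_ne_top]
    exact weightedSq_le_sum hL hf hv
  have h2 : (ENNReal.ofReal (sobolevConst L m))⁻¹ * W ≤ sobolevNorm L m f ^ 2 := by
    calc (ENNReal.ofReal (sobolevConst L m))⁻¹ * W
        = (((ENNReal.ofReal (sobolevConst L m))⁻¹ * W) ^ (1 / 2 : ℝ)) ^ 2 := by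
          rw [← ENNReal.rpow_natCast, ← ENNReal.rpow_mul]
          norm_num
      _ ≤ _ := by gcongr
  rwa [ENNReal.inv_mul_le_iff hc0 ENNReal.ofReal_ne_top] at h2


/-! ### Uniqueness of Fourier coefficients and Fourier inversion -/

lemma periodic_add_lattice {L : ℝ} {u : (Fin 3 → ℝ) → ℂ}
    (hu : ∀ j, Function.Periodic u (Pi.single j L)) (x : Fin 3 → ℝ) (n : Fin 3 → ℤ) :
    u (fun j => x j + n j * L) = u x := by
  have h : (fun j => x j + n j * L) = x + n 0 • (Pi.single 0 L : Fin 3 → ℝ) +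
      n 1 • (Pi.single 1 L : Fin 3 → ℝ) + n 2 • (Pi.single 2 L : Fin 3 → ℝ) := by
    ext j
    fin_cases j <;> simp
  rw [h, (hu 2).zsmul (n 2), (hu 1).zsmul (n 1), (hu 0).zsmul (n 0)]

/-- The projection of `ℝ³` onto the unit torus. -/
def torusMk : C(Fin 3 → ℝ, UnitAddTorus (Fin 3)) where
  toFun := Pi.map fun _ (t : ℝ) => (t : UnitAddCircle)
  continuous_toFun := (IsOpenQuotientMap.piMap fun _ : Fin 3 =>
    (QuotientAddGroup.isOpenQuotientMap_mk :
      IsOpenQuotientMap fun t : ℝ => (t : UnitAddCircle))).continuous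

lemma isQuotientMap_torusMk : Topology.IsQuotientMap torusMk :=
  (IsOpenQuotientMap.piMap fun _ : Fin 3 =>
    (QuotientAddGroup.isOpenQuotientMap_mk :
      IsOpenQuotientMap fun t : ℝ => (t : UnitAddCircle))).isQuotientMap

lemma mFourier_torusMk {L : ℝ} (k : Fin 3 → ℤ) (x : Fin 3 → ℝ) :
    UnitAddTorus.mFourier k (torusMk fun j => x j / L) = fourierMode L k x := by
  rw [fourierMode_eq_prod]
  change ∏ j, fourier (k j) (((x j / L : ℝ) : ℝ) : UnitAddCircle) = _
  refine Finset.prod_congr rfl fun j _ => ?_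
  rw [fourier_coe_apply]
  congr 1
  push_cast
  ring

lemma exists_torus_lift {L : ℝ} (hL : L ≠ 0) {u : (Fin 3 → ℝ) → ℂ} (hc : Continuous u)
    (hu : ∀ j, Function.Periodic u (Pi.single j L)) :
    ∃ F : C(UnitAddTorus (Fin 3), ℂ), ∀ x, F (torusMk fun j => x j / L) = u x := by
  let g : C(Fin 3 → ℝ, ℂ) := ⟨fun t => u fun j => t j * L, by fun_prop⟩
  have hg : Function.FactorsThrough g torusMk := by
    intro s t hst
    have h : ∀ j, ∃ n : ℤ, n • (1 : ℝ) = s j - t j := fun j => by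
      rw [← AddCircle.coe_eq_zero_iff, AddCircle.coe_sub, sub_eq_zero]
      exact congrFun hst j
    choose n hn using h
    change u (fun j => s j * L) = u fun j => t j * L
    rw [← periodic_add_lattice hu (fun j => t j * L) n]
    congr 1
    ext j
    have := hn j
    rw [zsmul_eq_mul, mul_one] at this
    rw [this]
    ring
  refine ⟨isQuotientMap_torusMk.lift g hg, fun x => ?_⟩
  have h := congrArg (fun G : C(Fin 3 → ℝ, ℂ) => G fun j => x j / L)
    (Topology.IsQuotientMap.lift_comp isQuotientMap_torusMk g hg)
  refine h.trans ?_
  change u (fun j => x j / L * L) = u x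
  congr 1
  ext j
  field_simp

/-- The functional `G ↦ ∫ u G` is continuous on `C(𝕋³)` and kills all modes, hence everything by
density. Taking `G` to be the conjugate of `u` itself gives `∫ |u|² = 0`, and continuity on the open
cell does the rest. -/
lemma eqOn_zero_of_fourierCoeffCell_eq_zero {L : ℝ} (hL : 0 < L) {u : (Fin 3 → ℝ) → ℂ}
    (hc : Continuous u) (hu : ∀ j, Function.Periodic u (Pi.single j L))
    (hz : ∀ k, fourierCoeffCell L u k = 0) : ∀ x ∈ cell L, u x = 0 := by
  have hL' : (L : ℂ) ≠ 0 := by exact_mod_cast hL.ne'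
  set p : (Fin 3 → ℝ) → UnitAddTorus (Fin 3) := fun x => torusMk fun j => x j / L
  have hp : Continuous p := torusMk.continuous.comp (by fun_prop)
  let I : C(UnitAddTorus (Fin 3), ℂ) →ₗ[ℂ] ℂ :=
    { toFun := fun G => ∫ x in cell L, u x * G (p x)
      map_add' := fun G H => by
        simp only [ContinuousMap.add_apply, mul_add]
        exact integral_add
          (integrable_cell_of_continuous L (hc.mul (G.continuous.comp hp)))
          (integrable_cell_of_continuous L (hc.mul (H.continuous.comp hp)))
      map_smul' := fun c G => by
        simp only [ContinuousMap.smul_apply, smul_eq_mul, RingHom.id_apply]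
        rw [← integral_const_mul]
        congr 1
        ext x
        ring }
  have hIb : ∀ G, ‖I G‖ ≤ (∫ x in cell L, ‖u x‖) * ‖G‖ := by
    intro G
    rw [← integral_mul_const]
    refine norm_integral_le_of_norm_le
      ((integrable_cell_of_continuous L hc.norm).mul_const _)
      (Filter.Eventually.of_forall fun x => ?_)
    rw [norm_mul]
    gcongr
    exact G.norm_coe_le_norm _
  have hIc : Continuous I := (I.mkContinuous _ hIb).continuous
  have hI0 : ∀ k, I (UnitAddTorus.mFourier k) = 0 := by
    intro k
    have h := hz (-k)
    rw [fourierCoeffCell, neg_neg, mul_eq_zero, or_iff_right (by simp [hL'])] at h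
    rw [← h]
    change ∫ x in cell L, u x * UnitAddTorus.mFourier k (p x) = _
    simp only [p, mFourier_torusMk]
  have hIall : ∀ G, I G = 0 := by
    intro G
    have hG : G ∈ (Submodule.span ℂ
        (Set.range (UnitAddTorus.mFourier (d := Fin 3)))).topologicalClosure := by
      rw [UnitAddTorus.span_mFourier_closure_eq_top]
      trivial
    have hle : Submodule.span ℂ (Set.range (UnitAddTorus.mFourier (d := Fin 3))) ≤
        LinearMap.ker I := by
      rw [Submodule.span_le]
      rintro _ ⟨k, rfl⟩
      exact hI0 k
    exact Submodule.topologicalClosure_minimal _ hle (isClosed_singleton.preimage hIc) hG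
  obtain ⟨F, hF⟩ := exists_torus_lift hL.ne' hc hu
  have h0 : ∫ x in cell L, ‖u x‖ ^ 2 = 0 := by
    have h := hIall (star F)
    have h' : ∫ x in cell L, ((‖u x‖ ^ 2 : ℝ) : ℂ) = 0 := by
      rw [← h]
      change _ = ∫ x in cell L, u x * (star F) (p x)
      refine integral_congr_ae (Filter.Eventually.of_forall fun x => ?_)
      simp only [ContinuousMap.star_apply, p, hF]
      rw [← starRingEnd_apply, Complex.mul_conj, Complex.normSq_eq_norm_sq]
    rw [integral_complex_ofReal] at h'
    exact_mod_cast h'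
  have hcont : Continuous fun x => ‖u x‖ ^ 2 := by fun_prop
  rw [integral_eq_zero_iff_of_nonneg (fun x => by positivity)
    (integrable_cell_of_continuous L hcont)] at h0
  have h1 := Measure.eqOn_open_of_ae_eq h0 (isOpen_cell L) hcont.continuousOn continuousOn_const
  intro x hx
  simpa using h1 hx

lemma fourierCoeffCell_tsum {L : ℝ} (hL : 0 < L) {a : (Fin 3 → ℤ) → ℂ}
    (ha : Summable fun k => ‖a k‖) (l : Fin 3 → ℤ) :
    fourierCoeffCell L (fun x => ∑' k, a k * fourierMode L k x) l = a l := by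
  have hL' : (L : ℂ) ≠ 0 := by exact_mod_cast hL.ne'
  have hterm : ∀ k x, a k * fourierMode L k x * fourierMode L (-l) x =
      a k * fourierMode L (k - l) x := fun k x => by
    rw [sub_eq_add_neg, fourierMode_add, mul_assoc]
  have hs := hasSum_integral_of_summable_integral_norm (μ := volume.restrict (cell L))
    (F := fun k x => a k * fourierMode L (k - l) x)
    (fun k => integrable_cell_of_continuous L (by fun_prop))
    (by
      simp only [norm_mul, norm_fourierMode, mul_one, integral_const, smul_eq_mul]
      exact ha.mul_left _)
  have h1 : ∀ k, ∫ x in cell L, a k * fourierMode L (k - l) x =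
      if k = l then a l * (L : ℂ) ^ 3 else 0 := fun k => by
    rw [integral_const_mul, integral_fourierMode hL]
    simp only [sub_eq_zero]
    split_ifs with h
    · rw [h]
    · rw [mul_zero]
  simp only [h1] at hs
  have h2 := hs.unique (hasSum_ite_eq l (a l * (L : ℂ) ^ 3))
  have h3 : ∫ x in cell L, (∑' k, a k * fourierMode L k x) * fourierMode L (-l) x =
      a l * (L : ℂ) ^ 3 := by
    rw [← h2]
    congr 1
    ext x
    rw [← tsum_mul_right]
    exact tsum_congr fun k => hterm k x
  rw [fourierCoeffCell, h3]
  field_simp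

/-- The series is continuous, periodic and has the same coefficients as `u`, so uniqueness applies
to the difference. -/
lemma eq_tsum_fourierCoeffCell {L : ℝ} (hL : 0 < L) {u : (Fin 3 → ℝ) → ℂ}
    (hc : Continuous u) (hu : ∀ j, Function.Periodic u (Pi.single j L))
    (hs : Summable fun k => ‖fourierCoeffCell L u k‖) :
    ∀ x ∈ cell L, u x = ∑' k, fourierCoeffCell L u k * fourierMode L k x := by
  set a := fourierCoeffCell L u with ha
  set s : (Fin 3 → ℝ) → ℂ := fun x => ∑' k, a k * fourierMode L k x with hsdef
  have hsc : Continuous s :=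
    continuous_tsum (fun k => by fun_prop) hs fun k x => by simp [norm_fourierMode]
  have hsp : ∀ j, Function.Periodic s (Pi.single j L) := fun j x => by
    simp only [s, fourierMode_periodic hL.ne' _ j x]
  have hz : ∀ k, fourierCoeffCell L (fun x => u x - s x) k = 0 := by
    intro k
    have h1 : fourierCoeffCell L (fun x => u x - s x) k = a k - fourierCoeffCell L s k := by
      rw [ha, fourierCoeffCell, fourierCoeffCell, fourierCoeffCell, ← mul_sub, ← integral_sub
        (integrable_cell_of_continuous L (by fun_prop))
        (integrable_cell_of_continuous L (by fun_prop))]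
      simp only [sub_mul]
    rw [h1, hsdef, fourierCoeffCell_tsum hL hs, sub_self]
  intro x hx
  exact sub_eq_zero.1 (eqOn_zero_of_fourierCoeffCell_eq_zero hL (u := fun x => u x - s x) (hc.sub hsc)
    (fun j => (hu j).sub (hsp j)) hz x hx)


/-! ### The quadrature error -/

/-- The half-step shift keeps all nodes off the boundary, so identities on the open cell suffice for
both the sum and the integral. -/
lemma gridPoint_mem_cell {L h : ℝ} (hL : 0 < L) {N : ℕ} (hN : 0 < N) (hh : h = L / N)
    {i : Fin 3 → ℤ} (hi : i ∈ Fintype.piFinset (fun _ : Fin 3 => Finset.Icc (1 : ℤ) (N : ℤ))) :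
    gridPoint h i ∈ cell L := by
  have hN' : (0 : ℝ) < N := by exact_mod_cast hN
  have hh0 : 0 < h := by rw [hh]; positivity
  have hNh : (N : ℝ) * h = L := by
    rw [hh]
    field_simp
  intro j _
  obtain ⟨h1, h2⟩ := Finset.mem_Icc.1 (Fintype.mem_piFinset.1 hi j)
  have h1' : (1 : ℝ) ≤ i j := by exact_mod_cast h1
  have h2' : (i j : ℝ) ≤ N := by exact_mod_cast h2
  refine ⟨mul_pos (by linarith) hh0, ?_⟩
  rw [← hNh]
  exact mul_lt_mul_of_pos_right (by linarith) hh0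

lemma quadrature_error_eq_tsum {L h : ℝ} (hL : 0 < L) {N : ℕ} (hN : 0 < N) (hh : h = L / N)
    {f g : (Fin 3 → ℝ) → ℝ} {a b : (Fin 3 → ℤ) → ℂ} (ha : Summable fun k => ‖a k‖)
    (hb : Summable fun k => ‖b k‖)
    (hf : ∀ x ∈ cell L, (f x : ℂ) = ∑' k, a k * fourierMode L k x)
    (hg : ∀ x ∈ cell L, (g x : ℂ) = ∑' k, b k * fourierMode L k x) :
    ((discreteInner h N (gridFun h f) (gridFun h g) - l2Inner L f g : ℝ) : ℂ) =
      ∑' p : (Fin 3 → ℤ) × (Fin 3 → ℤ), a p.1 * b p.2 * aliasing L N h (p.1 + p.2) := by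
  have hab : Summable fun p : (Fin 3 → ℤ) × (Fin 3 → ℤ) => ‖a p.1 * b p.2‖ := by
    simpa only [norm_mul] using
      ha.mul_of_nonneg hb (fun _ => norm_nonneg _) fun _ => norm_nonneg _
  have hsum : ∀ x, Summable fun p : (Fin 3 → ℤ) × (Fin 3 → ℤ) =>
      a p.1 * b p.2 * fourierMode L (p.1 + p.2) x := fun x =>
    Summable.of_norm (by simpa only [norm_mul (a _ * b _), norm_fourierMode, mul_one] using hab)
  have hprod : ∀ x ∈ cell L, ((f x * g x : ℝ) : ℂ) =
      ∑' p : (Fin 3 → ℤ) × (Fin 3 → ℤ), a p.1 * b p.2 * fourierMode L (p.1 + p.2) x := by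
    intro x hx
    rw [Complex.ofReal_mul, hf x hx, hg x hx, tsum_mul_tsum_of_summable_norm
      (by simpa only [norm_mul, norm_fourierMode, mul_one] using ha)
      (by simpa only [norm_mul, norm_fourierMode, mul_one] using hb)]
    refine tsum_congr fun p => ?_
    rw [fourierMode_add]
    ring
  have hD : ((discreteInner h N (gridFun h f) (gridFun h g) : ℝ) : ℂ) =
      ∑' p : (Fin 3 → ℤ) × (Fin 3 → ℤ), a p.1 * b p.2 * ((h : ℂ) ^ 3 *
        ∑ i ∈ Fintype.piFinset (fun _ : Fin 3 => Finset.Icc (1 : ℤ) (N : ℤ)),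
          fourierMode L (p.1 + p.2) (gridPoint h i)) := by
    simp only [discreteInner, gridFun]
    rw [Complex.ofReal_mul, Complex.ofReal_pow, Complex.ofReal_sum,
      Finset.sum_congr rfl fun i hi => hprod _ (gridPoint_mem_cell hL hN hh hi),
      ← Summable.tsum_finsetSum fun i _ => hsum (gridPoint h i), ← tsum_mul_left]
    refine tsum_congr fun p => ?_
    rw [← Finset.mul_sum]
    ring
  have hI := hasSum_integral_of_summable_integral_norm (μ := volume.restrict (cell L))
    (F := fun (p : (Fin 3 → ℤ) × (Fin 3 → ℤ)) x => a p.1 * b p.2 * fourierMode L (p.1 + p.2) x)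
    (fun p => integrable_cell_of_continuous L (by fun_prop))
    (by
      simp only [norm_mul (a _ * b _), norm_fourierMode, mul_one, integral_const, smul_eq_mul]
      exact hab.mul_left _)
  simp only [integral_const_mul] at hI
  have hI' : ((l2Inner L f g : ℝ) : ℂ) = ∑' p : (Fin 3 → ℤ) × (Fin 3 → ℤ),
      a p.1 * b p.2 * ∫ x in cell L, fourierMode L (p.1 + p.2) x := by
    rw [hI.tsum_eq, l2Inner, ← integral_complex_ofReal]
    exact setIntegral_congr_fun (measurableSet_cell L) hprod
  have hDs : Summable fun p : (Fin 3 → ℤ) × (Fin 3 → ℤ) => a p.1 * b p.2 * ((h : ℂ) ^ 3 *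
        ∑ i ∈ Fintype.piFinset (fun _ : Fin 3 => Finset.Icc (1 : ℤ) (N : ℤ)),
          fourierMode L (p.1 + p.2) (gridPoint h i)) := by
    refine ((summable_sum fun i (_ : i ∈ Fintype.piFinset
      (fun _ : Fin 3 => Finset.Icc (1 : ℤ) (N : ℤ))) => hsum (gridPoint h i)).mul_left
      ((h : ℂ) ^ 3)).congr fun p => ?_
    rw [← Finset.mul_sum]
    ring
  rw [Complex.ofReal_sub, hD, hI', ← hDs.tsum_sub hI.summable]
  refine tsum_congr fun p => ?_
  rw [aliasing]
  ring

/-- The grid inner product is exact on trigonometric polynomials of degree at most `K`. -/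
theorem discreteInner_eq_l2Inner_of_mem_trigPoly {L h : ℝ} (hL : 0 < L) {K N : ℕ}
    (hN : N = 2 * K + 1) (hh : h = L / N) {f g : (Fin 3 → ℝ) → ℝ} (hf : f ∈ trigPoly L K)
    (hg : g ∈ trigPoly L K) :
    discreteInner h N (gridFun h f) (gridFun h g) = l2Inner L f g := by
  obtain ⟨c, hc⟩ := hf
  obtain ⟨d, hd⟩ := hg
  have hN0 : 0 < N := by omega
  -- Extension by zero turns the polynomials into Fourier series, so the general error formula
  -- applies.
  let tr : ((Fin 3 → ℤ) → ℂ) → (Fin 3 → ℤ) → ℂ := fun c k => if k ∈ freqs K then c k else 0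
  have htr : ∀ c, Summable fun k => ‖tr c k‖ := fun c =>
    summable_of_ne_finset_zero (s := freqs K) fun k hk => by simp [tr, hk]
  have hrep : ∀ (c : (Fin 3 → ℤ) → ℂ) x, ∑ k ∈ freqs K, c k * fourierMode L k x =
      ∑' k, tr c k * fourierMode L k x := fun c x => by
    rw [tsum_eq_sum (s := freqs K) fun k hk => by simp [tr, hk]]
    exact Finset.sum_congr rfl fun k hk => by simp [tr, hk]
  have herr := quadrature_error_eq_tsum hL hN0 hh (htr c) (htr d)
    (fun x _ => (hc x).trans (hrep c x)) fun x _ => (hd x).trans (hrep d x)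
  have h0 : ∀ p : (Fin 3 → ℤ) × (Fin 3 → ℤ),
      tr c p.1 * tr d p.2 * aliasing L N h (p.1 + p.2) = 0 := by
    intro p
    by_cases h1 : p.1 ∈ freqs K
    · by_cases h2 : p.2 ∈ freqs K
      · by_cases hdvd : ∀ j, (N : ℤ) ∣ (p.1 + p.2) j
        · have : p.1 + p.2 = 0 := by
            ext j
            have e1 := Finset.mem_Icc.1 (Fintype.mem_piFinset.1 h1 j)
            have e2 := Finset.mem_Icc.1 (Fintype.mem_piFinset.1 h2 j)
            -- The sum of two coordinates has absolute value at most `2K = N - 1`.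
            refine Int.eq_zero_of_abs_lt_dvd (hdvd j) ?_
            rw [Pi.add_apply, abs_lt, hN]
            push_cast
            constructor <;> linarith [e1.1, e1.2, e2.1, e2.2]
          rw [this, aliasing_zero hL hN0 hh, mul_zero]
        · rw [aliasing_of_not_dvd hL hN0 hh hdvd, mul_zero]
      · simp [tr, h2]
    · simp [tr, h1]
  rw [tsum_congr h0, tsum_zero] at herr
  exact sub_eq_zero.1 (by exact_mod_cast herr)

/-! ### The error bound by Sobolev norms. -/

lemma le_two_mul_norm_of_dvd {N : ℕ} {k l : Fin 3 → ℤ} (hdvd : ∀ j, (N : ℤ) ∣ (k + l) j)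
    (h0 : k + l ≠ 0) : (N : ℝ) ≤ 2 * ‖k‖ ∨ (N : ℝ) ≤ 2 * ‖l‖ := by
  obtain ⟨j, hj⟩ := Function.ne_iff.1 h0
  have h1 : (N : ℤ) ≤ |(k + l) j| :=
    Int.le_of_dvd (abs_pos.2 hj) ((dvd_abs _ _).2 (hdvd j))
  have h2 : (N : ℝ) ≤ |(k j : ℝ)| + |(l j : ℝ)| := by
    have : (N : ℤ) ≤ |k j| + |l j| := h1.trans (abs_add_le _ _)
    exact_mod_cast this
  have hk := norm_le_pi_norm k j
  have hl := norm_le_pi_norm l j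
  rw [Int.norm_eq_abs] at hk hl
  by_contra! hcon
  linarith [hcon.1, hcon.2]

open Classical in
/-- The sum of `|a k| |b l|` over aliased pairs whose first frequency is high. -/
def aliasSum (N : ℕ) (a b : (Fin 3 → ℤ) → ℂ) : ℝ≥0∞ :=
  ∑' p : (Fin 3 → ℤ) × (Fin 3 → ℤ),
    if (∀ j, (N : ℤ) ∣ (p.1 + p.2) j) ∧ (N : ℝ) ≤ 2 * ‖p.1‖ then ‖a p.1‖ₑ * ‖b p.2‖ₑ else 0

/-- Pairs with `k + l = 0` or outside the lattice `Nℤ³` contribute nothing; every other pair has a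
high frequency and is counted in one of the two sums. -/
lemma enorm_tsum_aliasing_le {L h : ℝ} (hL : 0 < L) {N : ℕ} (hN : 0 < N) (hh : h = L / N)
    (a b : (Fin 3 → ℤ) → ℂ) :
    ‖∑' p : (Fin 3 → ℤ) × (Fin 3 → ℤ), a p.1 * b p.2 * aliasing L N h (p.1 + p.2)‖ₑ ≤
      ENNReal.ofReal (L ^ 3) * (aliasSum N a b + aliasSum N b a) := by
  classical
  have hswap : aliasSum N b a = ∑' p : (Fin 3 → ℤ) × (Fin 3 → ℤ),
      if (∀ j, (N : ℤ) ∣ (p.2 + p.1) j) ∧ (N : ℝ) ≤ 2 * ‖p.2‖ then ‖b p.2‖ₑ * ‖a p.1‖ₑ else 0 := by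
    rw [aliasSum, ← (Equiv.prodComm (Fin 3 → ℤ) (Fin 3 → ℤ)).tsum_eq]
    rfl
  refine enorm_tsum_le_tsum_enorm.trans ?_
  rw [hswap, aliasSum, ← ENNReal.tsum_add, ← ENNReal.tsum_mul_left]
  refine ENNReal.tsum_le_tsum fun p => ?_
  by_cases hdvd : ∀ j, (N : ℤ) ∣ (p.1 + p.2) j
  · rcases eq_or_ne (p.1 + p.2) 0 with h0 | h0
    · rw [h0, aliasing_zero hL hN hh, mul_zero, enorm_zero]
      exact zero_le
    · have hA : ‖aliasing L N h (p.1 + p.2)‖ₑ ≤ ENNReal.ofReal (L ^ 3) := by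
        rw [← ofReal_norm]
        exact ENNReal.ofReal_le_ofReal (norm_aliasing_le hL hN hh _)
      have hdvd' : ∀ j, (N : ℤ) ∣ (p.2 + p.1) j := by
        rw [add_comm]
        exact hdvd
      rw [enorm_mul, enorm_mul, mul_comm]
      refine mul_le_mul' hA ?_
      rcases le_two_mul_norm_of_dvd hdvd h0 with h1 | h1
      · rw [if_pos ⟨hdvd, h1⟩]
        exact le_self_add
      · rw [if_pos (⟨hdvd', h1⟩ : (∀ j, (N : ℤ) ∣ (p.2 + p.1) j) ∧ (N : ℝ) ≤ 2 * ‖p.2‖),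
          mul_comm ‖b p.2‖ₑ]
        exact le_add_self
  · rw [aliasing_of_not_dvd hL hN hh hdvd, mul_zero, enorm_zero]
    exact zero_le

/-- The constant in the bound of `aliasSum` by Sobolev norms. -/
def aliasSobolevConst (L : ℝ) : ℝ :=
  √(aliasConst.toReal * sobolevConst L 8 * sobolevConst L 2) * (4 / L) ^ 8

lemma aliasSum_le {L h : ℝ} (hL : 0 < L) {N : ℕ} (hN : 0 < N) (hh : h = L / N)
    {f g : (Fin 3 → ℝ) → ℝ} (hf : Continuous f) (hg : Continuous g) :
    aliasSum N (fourierCoeffCell L fun x => (f x : ℂ)) (fourierCoeffCell L fun x => (g x : ℂ)) ≤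
      ENNReal.ofReal (aliasSobolevConst L * h ^ 8) * (sobolevNorm L 8 f * sobolevNorm L 2 g) := by
  have hN' : (0 : ℝ) < N := by exact_mod_cast hN
  have hh0 : 0 < h := by rw [hh]; positivity
  have h8 := sobolevConst_pos hL 8
  have h2 := sobolevConst_pos hL 2
  have hA : 0 ≤ aliasConst.toReal := ENNReal.toReal_nonneg
  have h4 : 4 / (N : ℝ) = 4 / L * h := by
    rw [hh]
    field_simp
  -- Squaring both sides matches the Cauchy-Schwarz bound, where `(4/N)¹⁶ = ((4/L)⁸ h⁸)²`.
  rw [← ENNReal.pow_le_pow_left_iff two_ne_zero]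
  refine (tsum_alias_high_sq_le hN _ _).trans ?_
  calc _ ≤ aliasConst * ENNReal.ofReal (4 / N) ^ 16 *
        ((ENNReal.ofReal (sobolevConst L 8) * sobolevNorm L 8 f ^ 2) *
          (ENNReal.ofReal (sobolevConst L 2) * sobolevNorm L 2 g ^ 2)) := by
        gcongr
        · exact weightedSq_le_sobolevNorm hL hf 8
        · exact weightedSq_le_sobolevNorm hL hg 2
    _ = (aliasConst * ENNReal.ofReal (sobolevConst L 8) * ENNReal.ofReal (sobolevConst L 2) *
          ENNReal.ofReal (4 / N) ^ 16) * (sobolevNorm L 8 f * sobolevNorm L 2 g) ^ 2 := by ring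
    _ = _ := by
      rw [mul_pow (ENNReal.ofReal _)]
      congr 1
      rw [← ENNReal.ofReal_toReal aliasConst_ne_top, ← ENNReal.ofReal_mul hA,
        ← ENNReal.ofReal_mul (by positivity), ← ENNReal.ofReal_pow (by positivity),
        ← ENNReal.ofReal_mul (by positivity),
        ← ENNReal.ofReal_pow (by rw [aliasSobolevConst]; positivity)]
      congr 1
      rw [aliasSobolevConst, mul_pow, mul_pow, Real.sq_sqrt (by positivity), h4]
      ring

lemma eqOn_zero_of_sobolevNorm_eq_zero {L : ℝ} (hL : 0 < L) {f : (Fin 3 → ℝ) → ℝ}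
    (hf : Continuous f) (hp : IsPeriodic L f) {m : ℕ} (h0 : sobolevNorm L m f = 0) :
    ∀ x ∈ cell L, f x = 0 := by
  have hW := weightedSq_le_sobolevNorm hL hf m
  rw [h0, zero_pow two_ne_zero, mul_zero, nonpos_iff_eq_zero, weightedSq, ENNReal.tsum_eq_zero] at hW
  have hz : ∀ k, fourierCoeffCell L (fun x => (f x : ℂ)) k = 0 := by
    intro k
    have := (mul_eq_zero.1 (hW k)).resolve_left (pow_ne_zero _ (freqWeight_ne_zero k))
    simpa using this
  intro x hx
  have := eqOn_zero_of_fourierCoeffCell_eq_zero hL (u := fun x => (f x : ℂ)) (by fun_prop)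
    (fun j x => by simp only [hp j x]) hz x hx
  exact_mod_cast this

lemma quadrature_error_eq_zero {L h : ℝ} (hL : 0 < L) {N : ℕ} (hN : 0 < N) (hh : h = L / N)
    {f g : (Fin 3 → ℝ) → ℝ} (h0 : ∀ x ∈ cell L, f x * g x = 0) :
    discreteInner h N (gridFun h f) (gridFun h g) - l2Inner L f g = 0 := by
  simp only [discreteInner, gridFun, l2Inner]
  rw [setIntegral_eq_zero_of_forall_eq_zero h0,
    Finset.sum_eq_zero fun i hi => h0 _ (gridPoint_mem_cell hL hN hh hi), mul_zero, sub_zero]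

lemma weightedSq_ne_top {L : ℝ} (hL : 0 < L) {f : (Fin 3 → ℝ) → ℝ} (hf : Continuous f) {m : ℕ}
    (h : sobolevNorm L m f ≠ ⊤) : weightedSq m (fourierCoeffCell L fun x => (f x : ℂ)) ≠ ⊤ :=
  ne_top_of_le_ne_top (ENNReal.mul_ne_top ENNReal.ofReal_ne_top (ENNReal.pow_ne_top h))
    (weightedSq_le_sobolevNorm hL hf m)

/-- The quadrature error of the grid inner product is of order `h⁸`. -/
theorem quadrature_error_le {L h : ℝ} (hL : 0 < L) {N : ℕ} (hN : 0 < N) (hh : h = L / N)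
    {f g : (Fin 3 → ℝ) → ℝ} (hf : Continuous f) (hfp : IsPeriodic L f) (hg : Continuous g)
    (hgp : IsPeriodic L g) {C : ℝ} (hC : L ^ 3 * aliasSobolevConst L ≤ C) (hC0 : 0 < C) :
    ENNReal.ofReal |discreteInner h N (gridFun h f) (gridFun h g) - l2Inner L f g| ≤
      ENNReal.ofReal (C * h ^ 8) *
        (sobolevNorm L 8 f * sobolevNorm L 2 g + sobolevNorm L 2 f * sobolevNorm L 8 g) := by
  have hN' : (0 : ℝ) < N := by exact_mod_cast hN
  have hh0 : 0 < h := by rw [hh]; positivity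
  -- With `0 · ∞ = 0` the right side may vanish although an `H⁸` norm is infinite. A zero `H²` norm
  -- forces the function to vanish on the cell, so the error is zero too.
  by_cases hf0 : sobolevNorm L 2 f = 0
  · rw [quadrature_error_eq_zero hL hN hh fun x hx => by
      rw [eqOn_zero_of_sobolevNorm_eq_zero hL hf hfp hf0 x hx, zero_mul]]
    simp
  by_cases hg0 : sobolevNorm L 2 g = 0
  · rw [quadrature_error_eq_zero hL hN hh fun x hx => by
      rw [eqOn_zero_of_sobolevNorm_eq_zero hL hg hgp hg0 x hx, mul_zero]]
    simp
  have hCh : ENNReal.ofReal (C * h ^ 8) ≠ 0 := by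
    rw [Ne, ENNReal.ofReal_eq_zero, not_le]
    positivity
  -- Both `H²` norms are now nonzero, so an infinite `H⁸` norm makes the right side infinite.
  by_cases hf8 : sobolevNorm L 8 f = ⊤
  · rw [hf8, ENNReal.top_mul hg0, top_add, ENNReal.mul_top hCh]
    exact le_top
  by_cases hg8 : sobolevNorm L 8 g = ⊤
  · rw [hg8, ENNReal.mul_top hf0, add_top, ENNReal.mul_top hCh]
    exact le_top
  have hexp : ∀ {u : (Fin 3 → ℝ) → ℝ}, Continuous u → sobolevNorm L 8 u ≠ ⊤ →
      Summable fun k => ‖fourierCoeffCell L (fun x => (u x : ℂ)) k‖ := fun hu h8 =>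
    summable_norm_of_weightedSq_ne_top
      (ne_top_of_le_ne_top (weightedSq_ne_top hL hu h8) (weightedSq_mono (by norm_num) _))
  have herr := quadrature_error_eq_tsum hL hN hh (hexp hf hf8) (hexp hg hg8)
    (eq_tsum_fourierCoeffCell hL (by fun_prop) (fun j x => by simp only [hfp j x]) (hexp hf hf8))
    (eq_tsum_fourierCoeffCell hL (by fun_prop) (fun j x => by simp only [hgp j x]) (hexp hg hg8))
  rw [← Real.norm_eq_abs, ← Complex.norm_real, ofReal_norm, herr]
  refine (enorm_tsum_aliasing_le hL hN hh _ _).trans ?_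
  calc _ ≤ ENNReal.ofReal (L ^ 3) * (ENNReal.ofReal (aliasSobolevConst L * h ^ 8) *
          (sobolevNorm L 8 f * sobolevNorm L 2 g) + ENNReal.ofReal (aliasSobolevConst L * h ^ 8) *
          (sobolevNorm L 8 g * sobolevNorm L 2 f)) := by
        gcongr
        · exact aliasSum_le hL hN hh hf hg
        · exact aliasSum_le hL hN hh hg hf
    _ = ENNReal.ofReal (L ^ 3 * aliasSobolevConst L * h ^ 8) *
        (sobolevNorm L 8 f * sobolevNorm L 2 g + sobolevNorm L 2 f * sobolevNorm L 8 g) := by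
        rw [mul_assoc (L ^ 3), ENNReal.ofReal_mul (p := L ^ 3) (by positivity)]
        ring
    _ ≤ _ := by gcongr

end PeriodicGrid

end

theorem lemma2p4 (L : ℝ) (hL : 0 < L) :
    (∀ (K N : ℕ) (h : ℝ), N = 2 * K + 1 → h = L / N →
      ∀ f g : (Fin 3 → ℝ) → ℝ, f ∈ PeriodicGrid.trigPoly L K → g ∈ PeriodicGrid.trigPoly L K →
        PeriodicGrid.discreteInner h N (PeriodicGrid.gridFun h f) (PeriodicGrid.gridFun h g) =
          PeriodicGrid.l2Inner L f g) ∧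
    (∃ C : ℝ, 0 < C ∧ ∀ (K N : ℕ) (h : ℝ), N = 2 * K + 1 → h = L / N →
      ∀ f g : (Fin 3 → ℝ) → ℝ, Continuous f → PeriodicGrid.IsPeriodic L f →
        Continuous g → PeriodicGrid.IsPeriodic L g →
        ENNReal.ofReal
            |PeriodicGrid.discreteInner h N (PeriodicGrid.gridFun h f) (PeriodicGrid.gridFun h g) -
              PeriodicGrid.l2Inner L f g| ≤
          ENNReal.ofReal (C * h ^ 8) *
            (PeriodicGrid.sobolevNorm L 8 f * PeriodicGrid.sobolevNorm L 2 g +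
              PeriodicGrid.sobolevNorm L 2 f * PeriodicGrid.sobolevNorm L 8 g)) := by
  refine ⟨fun K N h hN hh f g hf hg =>
    PeriodicGrid.discreteInner_eq_l2Inner_of_mem_trigPoly hL hN hh hf hg,
    -- The maximum with `1` makes positivity of the constant immediate.
    max (L ^ 3 * PeriodicGrid.aliasSobolevConst L) 1, by positivity, ?_⟩
  intro K N h hN hh f g hf hfp hg hgp
  exact PeriodicGrid.quadrature_error_le hL (by omega) hh hf hfp hg hgp (le_max_left _ _)
    (by positivity)
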